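/- Throughout, algebras are over $\mathbb{C}$, and in a table of multiplication the omitted products of basis vectors are zero. A Leibniz algebra is an algebra satisfying $[x,[y,z]]=[[x,y],z]-[[x,z],y]$. A $k$-dimensional central extension of a Leibniz algebra $L$ is a Leibniz algebra $\widehat L$ fitting into a short exact sequence of Leibniz algebras $0\to V\to\widehat L\to L\to 0$ in which $V$ is abelian, $\dim V=k$, and the image of $V$ lies in the (two-sided) center of $\widehat L$. An algebra is split if it is the direct sum of two nonzero two-sided ideals. Let $n\ge 4$ and let $F_n^1$ be the algebra with basis $e_1,\dots,e_n$ and products $$[e_1,e_1]=e_3,\qquad [e_i,e_1]=e_{i+1}\quad (2\le i\le n-1).$$ **Theorem 4.4.** Every two-dimensional non-split central extension of $F_n^1$ is isomorphic, as an algebra, to one of the following algebras with basis $e_1,\dots,e_{n+2}$. These are pairwise non-isomorphic (distinct entries of the list, including distinct values of the parameters, give non-isomorphic algebras), and each of them is a two-dimensional non-split central extension of $F_n^1$: * $L(1,0,0,0)$, $L(1,1,0,0)$, $L(0,1,0,0)$, $L(0,1,1,0)$, $L(1,0,0,\beta_4)$ with $\beta_4\in\mathbb{C}\setminus\{0\}$,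 $L(0,1,-1,0)$, $L(0,1,1,1)$, $L(0,1,2,4)$, where $$L(\alpha_3,\alpha_4,\beta_3,\beta_4):\quad [e_i,e_1]=e_{i+1}\ (1\le i\le n-1),\quad [e_{n+1},e_1]=e_2+e_{n+2},\quad [e_1,e_{n+1}]=\alpha_3e_n+\beta_3e_{n+2},\quad [e_{n+1},e_{n+1}]=\alpha_4e_n+\beta_4e_{n+2};$$ * $M(1,\beta_4)$ with $\beta_4\in\mathbb{C}\setminus\{1\}$, $M(0,0)$, $M(0,1)$, $M(0,2)$, $M(2,1)$, $M(2,2)$, $M(1,1)$, where $$M(\alpha_4,\beta_4):\quad [e_i,e_1]=e_{i+1}\ (1\le i\le n-2),\quad [e_n,e_1]=e_2+e_{n+1},\quad [e_1,e_n]=e_{n+2},\quad [e_n,e_n]=\alpha_4e_{n+1}+\beta_4e_{n+2};$$ * $L_{n+2}^1:\quad [e_i,e_1]=e_{i+1}\ (1\le i\le n-1),\quad [e_1,e_{n+1}]=e_{n+2}+e_2,\quad [e_i,e_{n+1}]=e_{i+1}\ (2\le i\le n-1)$; * $L_{n+2}^{3,\lambda}$ with $\lambda\in\{-1,0,1\}$: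 $\quad [e_i,e_1]=e_{i+1}\ (1\le i\le n-1),\quad [e_{n+1},e_1]=e_{n+2}+e_2,\quad [e_1,e_{n+1}]=\lambda e_{n+2}$; * $L_{n+2}^{4,\lambda}$ with $\lambda\in\mathbb{C}\setminus\{0\}$: $\quad [e_i,e_1]=e_{i+1}\ (1\le i\le n-1),\quad [e_{n+1},e_1]=e_{n+2}+e_2,\quad [e_{n+1},e_{n+1}]=\lambda e_{n+2}$; * $L_{n+2}^{5,\lambda,\mu}$ with $(\lambda,\mu)\in\{(1,1),(2,4)\}$: $\quad [e_i,e_1]=e_{i+1}\ (1\le i\le n-1),\quad [e_{n+1},e_1]=e_{n+2}+e_2,\quad [e_1,e_{n+1}]=\lambda e_{n+2},\quad [e_{n+1},e_{n+1}]=\mu e_{n+2}$; * $L^*:\quad [e_i,e_1]=e_{i+1}\ (1\le i\le n-1),\quad [e_1,e_{n+1}]=e_2+e_{n+2},\quad [e_i,e_{n+1}]=e_{i+1}\ (2\le i\le n-1),\quad [e_{n+1},e_{n+1}]=e_n$. -/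

import Mathlib

namespace LeibnizExt

/-- The multiplication of a (not necessarily associative, commutative or unital)
algebra on a complex vector space. -/
abbrev Mult (E : Type*) [AddCommGroup E] [Module ℂ E] : Type _ := E →ₗ[ℂ] E →ₗ[ℂ] E

section General

variable {E E' : Type*} [AddCommGroup E] [Module ℂ E] [AddCommGroup E'] [Module ℂ E']

/-- The (right) Leibniz identity `[x, [y, z]] = [[x, y], z] - [[x, z], y]`. -/
def IsLeibniz (b : Mult E) : Prop :=
  ∀ x y z : E, b x (b y z) = b (b x y) z - b (b x z) y

/-- Isomorphism of algebras. -/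
def Isomorphic (b : Mult E) (b' : Mult E') : Prop :=
  ∃ φ : E ≃ₗ[ℂ] E', ∀ x y : E, φ (b x y) = b' (φ x) (φ y)

/-- Two-sided ideals. -/
def IsIdeal (b : Mult E) (I : Submodule ℂ E) : Prop :=
  ∀ x ∈ I, ∀ y : E, b x y ∈ I ∧ b y x ∈ I

/-- An algebra is split if it is the direct sum of two nonzero ideals. -/
def IsSplit (b : Mult E) : Prop :=
  ∃ I J : Submodule ℂ E, IsIdeal b I ∧ IsIdeal b J ∧ I ≠ ⊥ ∧ J ≠ ⊥ ∧ IsCompl I J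

/-- The Leibniz algebra `(E, bE)` is a `k`-dimensional central extension of `(L, bL)`:
there is a short exact sequence `0 → V → E → L → 0` of Leibniz algebras, where `V = ℂ^k` has
the zero multiplication and its image lies in the centre of `E`.  (The map `ε` is then
automatically multiplicative.) -/
def IsCentralExtension {L : Type*} [AddCommGroup L] [Module ℂ L]
    (k : ℕ) (bL : Mult L) (bE : Mult E) : Prop :=
  IsLeibniz bE ∧
  ∃ (ε : (Fin k → ℂ) →ₗ[ℂ] E) (π : E →ₗ[ℂ] L),
    Function.Injective ε ∧ Function.Surjective π ∧ LinearMap.range ε = LinearMap.ker π ∧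
    (∀ x y : E, π (bE x y) = bL (π x) (π y)) ∧
    (∀ (v : Fin k → ℂ) (x : E), bE (ε v) x = 0 ∧ bE x (ε v) = 0)

end General

/-- The standard basis vector `e_i` of `ℂ^m`, numbered from `1`: `e_1, …, e_m`. -/
def e {m : ℕ} (i : ℕ) : Fin m → ℂ := fun k => if (k : ℕ) + 1 = i then 1 else 0

/-- The algebra on `ℂ^m` with the table of multiplication `[e_i, e_j] = t i j`, `1 ≤ i, j ≤ m`. -/
noncomputable def ofTable (m : ℕ) (t : ℕ → ℕ → (Fin m → ℂ)) : Mult (Fin m → ℂ) :=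
  (Pi.basisFun ℂ (Fin m)).constr ℂ fun i =>
    (Pi.basisFun ℂ (Fin m)).constr ℂ fun j => t ((i : ℕ) + 1) ((j : ℕ) + 1)

theorem e_succ_eq_basisFun {m : ℕ} (i : Fin m) :
    (e ((i : ℕ) + 1) : Fin m → ℂ) = Pi.basisFun ℂ (Fin m) i := by
  funext k
  simp [e, Pi.single_apply, Fin.ext_iff]

theorem ofTable_e {m : ℕ} (t : ℕ → ℕ → (Fin m → ℂ)) {i j : ℕ}
    (hi : 1 ≤ i) (him : i ≤ m) (hj : 1 ≤ j) (hjm : j ≤ m) :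
    ofTable m t (e i) (e j) = t i j := by
  obtain ⟨i, rfl⟩ := Nat.exists_eq_add_of_le' hi
  obtain ⟨j, rfl⟩ := Nat.exists_eq_add_of_le' hj
  have h1 := e_succ_eq_basisFun (⟨i, him⟩ : Fin m)
  have h2 := e_succ_eq_basisFun (⟨j, hjm⟩ : Fin m)
  simp only at h1 h2
  rw [h1, h2, ofTable, Module.Basis.constr_basis, Module.Basis.constr_basis]

/-- `F_n^1 : [e_1, e_1] = e_3`, `[e_i, e_1] = e_{i+1}` for `2 ≤ i ≤ n - 1`. -/
noncomputable def algF1 (n : ℕ) : Mult (Fin n → ℂ) :=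
  ofTable n fun i j =>
    if i = 1 ∧ j = 1 then e 3
    else if 2 ≤ i ∧ i + 1 ≤ n ∧ j = 1 then e (i + 1)
    else 0

/-- `L_m^1` : `[e_i, e_1] = e_{i+1}` for `1 ≤ i ≤ m - 3`, `[e_1, e_{m-1}] = e_m + e_2`,
`[e_i, e_{m-1}] = e_{i+1}` for `2 ≤ i ≤ m - 3`. -/
noncomputable def algL1 (m : ℕ) : Mult (Fin m → ℂ) :=
  ofTable m fun i j =>
    if i + 3 ≤ m ∧ j = 1 then e (i + 1)
    else if i = 1 ∧ j + 1 = m then e m + e 2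
    else if 2 ≤ i ∧ i + 3 ≤ m ∧ j + 1 = m then e (i + 1)
    else 0

/-- `[e_i, e_1] = e_{i+1}` for `1 ≤ i ≤ m - 3`, `[e_{m-1}, e_1] = e_m + e_2`,
`[e_1, e_{m-1}] = l e_m`, `[e_{m-1}, e_{m-1}] = μ e_m`. This is `L_m^{5,l,μ}`; it is `L_m^{3,l}`
for `μ = 0` and `L_m^{4,μ}` for `l = 0`. -/
noncomputable def algL5 (m : ℕ) (l μ : ℂ) : Mult (Fin m → ℂ) :=
  ofTable m fun i j =>
    if i + 3 ≤ m ∧ j = 1 then e (i + 1)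
    else if i + 1 = m ∧ j = 1 then e m + e 2
    else if i = 1 ∧ j + 1 = m then l • e m
    else if i + 1 = m ∧ j + 1 = m then μ • e m
    else 0

/-- `L_m^{3,l}` (`l ∈ {-1, 0, 1}`). -/
noncomputable def algL3 (m : ℕ) (l : ℂ) : Mult (Fin m → ℂ) := algL5 m l 0

/-- `L_m^{4,l}` (`l ≠ 0`). -/
noncomputable def algL4 (m : ℕ) (l : ℂ) : Mult (Fin m → ℂ) := algL5 m 0 l

/-- `L(α₃, α₄, β₃, β₄)`, of dimension `n + 2`. -/
noncomputable def algL (n : ℕ) (α₃ α₄ β₃ β₄ : ℂ) : Mult (Fin (n + 2) → ℂ) :=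
  ofTable (n + 2) fun i j =>
    if i + 1 ≤ n ∧ j = 1 then e (i + 1)
    else if i = n + 1 ∧ j = 1 then e 2 + e (n + 2)
    else if i = 1 ∧ j = n + 1 then α₃ • e n + β₃ • e (n + 2)
    else if i = n + 1 ∧ j = n + 1 then α₄ • e n + β₄ • e (n + 2)
    else 0

/-- `M(α₄, β₄)`, of dimension `n + 2`. -/
noncomputable def algM (n : ℕ) (α₄ β₄ : ℂ) : Mult (Fin (n + 2) → ℂ) :=
  ofTable (n + 2) fun i j =>
    if i + 2 ≤ n ∧ j = 1 then e (i + 1)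
    else if i = n ∧ j = 1 then e 2 + e (n + 1)
    else if i = 1 ∧ j = n then e (n + 2)
    else if i = n ∧ j = n then α₄ • e (n + 1) + β₄ • e (n + 2)
    else 0

/-- `L*`, of dimension `n + 2`. -/
noncomputable def algLstar (n : ℕ) : Mult (Fin (n + 2) → ℂ) :=
  ofTable (n + 2) fun i j =>
    if i + 1 ≤ n ∧ j = 1 then e (i + 1)
    else if i = 1 ∧ j = n + 1 then e 2 + e (n + 2)
    else if 2 ≤ i ∧ i + 1 ≤ n ∧ j = n + 1 then e (i + 1)
    else if i = n + 1 ∧ j = n + 1 then e n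
    else 0

/-- The entries of the classification list. -/
inductive Entry : Type
  | L1000 | L1100 | L0100 | L0110
  | L100 (β₄ : ℂ) (h : β₄ ≠ 0)
  | L01neg10 | L0111 | L0124
  | M1 (β₄ : ℂ) (h : β₄ ≠ 1)
  | M00 | M01 | M02 | M21 | M22 | M11
  | quasi1
  | quasi3 (l : ℂ) (h : l = -1 ∨ l = 0 ∨ l = 1)
  | quasi4 (l : ℂ) (h : l ≠ 0)
  | quasi5 (l μ : ℂ) (h : (l = 1 ∧ μ = 1) ∨ (l = 2 ∧ μ = 4))
  | Lstar

/-- The algebra of dimension `n + 2` named by an entry of the list. -/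
noncomputable def Entry.alg (n : ℕ) : Entry → Mult (Fin (n + 2) → ℂ)
  | .L1000 => algL n 1 0 0 0
  | .L1100 => algL n 1 1 0 0
  | .L0100 => algL n 0 1 0 0
  | .L0110 => algL n 0 1 1 0
  | .L100 β₄ _ => algL n 1 0 0 β₄
  | .L01neg10 => algL n 0 1 (-1) 0
  | .L0111 => algL n 0 1 1 1
  | .L0124 => algL n 0 1 2 4
  | .M1 β₄ _ => algM n 1 β₄
  | .M00 => algM n 0 0
  | .M01 => algM n 0 1
  | .M02 => algM n 0 2
  | .M21 => algM n 2 1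
  | .M22 => algM n 2 2
  | .M11 => algM n 1 1
  | .quasi1 => algL1 (n + 2)
  | .quasi3 l _ => algL3 (n + 2) l
  | .quasi4 l _ => algL4 (n + 2) l
  | .quasi5 l μ _ => algL5 (n + 2) l μ
  | .Lstar => algLstar n

end LeibnizExt

namespace LeibnizExt

/-! Put `n = k + 2`. In the basis `c = e_1 - e_2`, `w_i = e_{i+2}` the algebra F_n^1 is a bare
shift: `[w_i, c] = w_{i+1}` for `i < k`, and all other products vanish. Lift `c` and `w_0` to a
central extension by `V` and define the later `w_i` by right multiplication by `c`. The Leibniz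
identity then leaves only four free vectors of `V`: `u = [c,c]`, `t = [c,w_0]`, `s = [w_0,w_0]`, `q
= [w_k,c]`. Every quadruple occurs (`IsCentralExtension.exists_model_isomorphic`,
`model_isLeibniz`). The extension is non-split exactly when the four vectors span `V`
(`Datum.spans_of_not_isSplit`, `Datum.Spans.not_isSplit`). Isomorphism then amounts to the action of
GL(V), of a two-dimensional torus rescaling `c` and `w_0`, and of a shift of `u` by multiples of `q`
(`Datum.Equivalent.isomorphic`, `Datum.equivalent_of_isomorphic`).

For dim V = 2, the group GL(V) is eliminated by passing to the six 2×2 minors of `(u,t,s,q)`, up to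
a common factor; they satisfy one Plücker relation. Write QU for the minor of `q` and `u`, and so
on. Under the torus `u, t, s` scale in geometric progression, hence so do QU, QT, QS, and so do UT,
US, TS apart from the shift, which adds multiples of QT, QS to UT, US. The invariants are therefore
the vanishing of QU, QT, QS, TS, the ratio QS·QU/QT², and, when QT = QS = 0 so that the shift is
harmless, the vanishing of UT, US and the ratio UT·TS/US². They are complete
(`Datum.Equivalent.same`, `Datum.Same.equivalent`), and the list meets each of their values exactly
once (`Entry.exists_same`, `Entry.eq_of_same`). -/

/-- Two elements `u, t, s, q` of a vector space, the structure constants of `model`. -/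
structure Datum (V : Type*) where
  u : V
  t : V
  s : V
  q : V

/-! ### The model extension attached to four vectors of the centre. -/

section Model

variable {V : Type*} [AddCommGroup V] [Module ℂ V] {k : ℕ}

/-- The underlying space of `model`, with basis vectors `c`, `w₀, …, w_k`, and the centre `V`. -/
abbrev Carrier (k : ℕ) (V : Type*) : Type _ := ℂ × (Fin (k + 1) → ℂ) × V

/-- The nilpotent shift `w_i ↦ w_{i+1}`. -/
def shift (x : Fin (k + 1) → ℂ) : Fin (k + 1) → ℂ := Fin.cons 0 (Fin.init x)

@[simp] theorem shift_zero_apply (x : Fin (k + 1) → ℂ) : shift x 0 = 0 := rfl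

@[simp] theorem shift_succ_apply (x : Fin (k + 1) → ℂ) (i : Fin k) :
    shift x i.succ = x i.castSucc := rfl

theorem shift_add (x y : Fin (k + 1) → ℂ) : shift (x + y) = shift x + shift y := by
  funext i
  induction i using Fin.cases <;> simp

theorem shift_smul (a : ℂ) (x : Fin (k + 1) → ℂ) : shift (a • x) = a • shift x := by
  funext i
  induction i using Fin.cases <;> simp

/-- The algebra with products `[w_i, c] = w_{i+1}` for `i < k`, `[w_k, c] = q`, `[c, c] = u`,
`[c, w₀] = t`, `[w₀, w₀] = s`. -/
def model (k : ℕ) (X : Datum V) : Mult (Carrier k V) :=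
  LinearMap.mk₂ ℂ
    (fun x y => (0, y.1 • shift x.2.1,
      (y.1 * x.2.1 (Fin.last k)) • X.q + (x.1 * y.1) • X.u + (x.1 * y.2.1 0) • X.t
        + (x.2.1 0 * y.2.1 0) • X.s))
    (fun x x' y => by
      ext1
      · simp
      · ext1
        · simp [shift_add]
        · simp only [Prod.fst_add, Prod.snd_add, Pi.add_apply]; module)
    (fun a x y => by
      ext1
      · simp
      · ext1
        · simp [shift_smul, smul_comm a]
        · simp only [Prod.smul_fst, Prod.smul_snd, Pi.smul_apply, smul_eq_mul]; module)
    (fun x y y' => by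
      ext1
      · simp
      · ext1
        · simp [add_smul]
        · simp only [Prod.fst_add, Prod.snd_add, Pi.add_apply]; module)
    (fun a x y => by
      ext1
      · simp
      · ext1
        · simp [mul_smul]
        · simp only [Prod.smul_fst, Prod.smul_snd, Pi.smul_apply, smul_eq_mul]; module)

theorem model_apply (X : Datum V) (x y : Carrier k V) :
    model k X x y = (0, y.1 • shift x.2.1,
      (y.1 * x.2.1 (Fin.last k)) • X.q + (x.1 * y.1) • X.u + (x.1 * y.2.1 0) • X.t
        + (x.2.1 0 * y.2.1 0) • X.s) := rfl

theorem model_apply_succ (X : Datum V) (x y : Carrier k V) (i : Fin k) :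
    (model k X x y).2.1 i.succ = y.1 * x.2.1 i.castSucc := rfl

/-- A product has no `c`- or `w_0`-coordinate, so right multiplication by it is zero. What remains
is that right multiplications commute on products, where only the `c`-coordinates of the two
multipliers enter. -/
theorem model_isLeibniz (X : Datum V) : IsLeibniz (model k X) := by
  intro x y z
  simp only [model_apply, shift_smul, Pi.smul_apply, shift_zero_apply, smul_eq_mul, mul_zero,
    zero_mul, zero_smul, add_zero]
  ext1
  · simp
  · ext1
    · simp [smul_comm y.1 z.1]
    · rw [Prod.snd_sub, Prod.snd_sub]
      module

/-- The basis vector `c`. -/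
def mc : Carrier k V := (1, 0, 0)

/-- The basis vector `w_i`. -/
def mw (i : Fin (k + 1)) : Carrier k V := (0, Pi.single i 1, 0)

/-- The inclusion of the centre. -/
def mv : V →ₗ[ℂ] Carrier k V := LinearMap.inr ℂ _ _ ∘ₗ LinearMap.inr ℂ _ _

@[simp] theorem mv_apply (v : V) : (mv v : Carrier k V) = (0, 0, v) := rfl

theorem shift_single_castSucc (i : Fin k) :
    shift (Pi.single i.castSucc 1) = Pi.single i.succ 1 := by
  funext j
  induction j using Fin.cases with
  | zero => simp [(Fin.succ_ne_zero i).symm]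
  | succ j => simp [Pi.single_apply]

theorem shift_single_last : shift (Pi.single (Fin.last k) 1) = 0 := by
  funext j
  induction j using Fin.cases with
  | zero => simp
  | succ j => simp [(Fin.castSucc_lt_last j).ne]

theorem shift_zero : shift (0 : Fin (k + 1) → ℂ) = 0 := by
  funext j
  induction j using Fin.cases <;> simp

theorem model_mw_castSucc_mc (X : Datum V) (i : Fin k) :
    model k X (mw i.castSucc) mc = mw i.succ := by
  simp [model_apply, mw, mc, shift_single_castSucc, Pi.single_apply,
    (Fin.castSucc_lt_last i).ne']

theorem model_mw_last_mc (X : Datum V) : model k X (mw (Fin.last k)) mc = mv X.q := by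
  simp [model_apply, mw, mc, shift_single_last]

theorem model_mc_mc (X : Datum V) : model k X mc mc = mv X.u := by
  simp [model_apply, mc, shift_zero]

theorem model_mc_mw (X : Datum V) : model k X mc (mw 0) = mv X.t := by
  simp [model_apply, mc, mw]

theorem model_mw_mw (X : Datum V) : model k X (mw 0) (mw 0) = mv X.s := by
  simp [model_apply, mw]

theorem model_mv_left (X : Datum V) (v : V) (y : Carrier k V) : model k X (mv v) y = 0 := by
  simp [model_apply, shift_zero]

theorem model_mv_right (X : Datum V) (v : V) (y : Carrier k V) : model k X y (mv v) = 0 := by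
  simp [model_apply]

theorem carrier_decomp (x : Carrier k V) : x = x.1 • mc + ∑ i, x.2.1 i • mw i + mv x.2.2 := by
  refine Prod.ext ?_ (Prod.ext ?_ ?_)
  · simp [mc, mw, Prod.fst_sum]
  · funext j
    simp [mc, mw, Prod.fst_sum, Prod.snd_sum, Finset.sum_apply, Pi.single_apply]
  · simp [mc, mw, Prod.snd_sum]

end Model

/-! ### Recognising an algebra as a model from generators and relations. -/

section Presentation

variable {V : Type*} [AddCommGroup V] [Module ℂ V] {k : ℕ}
variable {E : Type*} [AddCommGroup E] [Module ℂ E]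

/-- The elements `c`, `w₀, …, w_k` and the central subspace `ι V` of an algebra multiply as in
`model k X`. -/
structure Presents (b : Mult E) (X : Datum V) (k : ℕ) (c : E) (w : ℕ → E) (ι : V →ₗ[ℂ] E) :
    Prop where
  central_left : ∀ v x, b (ι v) x = 0
  central_right : ∀ v x, b x (ι v) = 0
  cc : b c c = ι X.u
  cw : b c (w 0) = ι X.t
  ww : b (w 0) (w 0) = ι X.s
  step : ∀ i < k, b (w i) c = w (i + 1)
  last : b (w k) c = ι X.q
  right_zero : ∀ x i, 1 ≤ i → i ≤ k → b x (w i) = 0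
  left_zero : ∀ i, 1 ≤ i → i ≤ k → b (w i) (w 0) = 0

/-- The linear map from the model to an algebra determined by the images of the basis. -/
def presMap (k : ℕ) (c : E) (w : ℕ → E) (ι : V →ₗ[ℂ] E) : Carrier k V →ₗ[ℂ] E where
  toFun x := x.1 • c + ∑ i : Fin (k + 1), x.2.1 i • w i + ι x.2.2
  map_add' x y := by
    simp only [Prod.fst_add, Prod.snd_add, Pi.add_apply, add_smul, Finset.sum_add_distrib, map_add]
    abel
  map_smul' a x := by
    simp only [Prod.smul_fst, Prod.smul_snd, Pi.smul_apply, smul_assoc, map_smul,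
      ← Finset.smul_sum, RingHom.id_apply, smul_add]

theorem presMap_apply (c : E) (w : ℕ → E) (ι : V →ₗ[ℂ] E) (x : Carrier k V) :
    presMap k c w ι x = x.1 • c + ∑ i : Fin (k + 1), x.2.1 i • w i + ι x.2.2 := rfl

theorem presMap_mc (c : E) (w : ℕ → E) (ι : V →ₗ[ℂ] E) : presMap k c w ι mc = c := by
  simp [presMap_apply, mc]

theorem presMap_mw (c : E) (w : ℕ → E) (ι : V →ₗ[ℂ] E) (i : Fin (k + 1)) :
    presMap k c w ι (mw i) = w i := by
  simp [presMap_apply, mw, Pi.single_apply]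

theorem presMap_mv (c : E) (w : ℕ → E) (ι : V →ₗ[ℂ] E) (v : V) :
    presMap k c w ι (mv v) = ι v := by
  simp [presMap_apply]

/-- Among the generators only `c` and `w 0` act non-trivially on the right, so two right
multiplications determine the product. -/
theorem Presents.presMap_mul {b : Mult E} {X : Datum V} {c : E} {w : ℕ → E} {ι : V →ₗ[ℂ] E}
    (h : Presents b X k c w ι) (x y : Carrier k V) :
    presMap k c w ι (model k X x y) = b (presMap k c w ι x) (presMap k c w ι y) := by
  have hr (z : E) : b z (presMap k c w ι y) = y.1 • b z c + y.2.1 0 • b z (w 0) := by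
    have : ∀ i : Fin k, b z (w (i.succ : Fin (k + 1))) = 0 :=
      fun i => h.right_zero z _ (by simp) (by simp)
    simp only [presMap_apply, map_add, map_smul, map_sum, h.central_right, add_zero,
      Fin.sum_univ_succ, this, smul_zero, Finset.sum_const_zero, Fin.val_zero]
  have hc : b (presMap k c w ι x) c = x.1 • ι X.u
      + (∑ i : Fin k, x.2.1 i.castSucc • w (i + 1) + x.2.1 (Fin.last k) • ι X.q) := by
    have : ∀ i : Fin k, b (w (i.castSucc : Fin (k + 1))) c = w (i + 1) :=
      fun i => h.step i i.2
    simp only [presMap_apply, map_add, map_smul, map_sum, LinearMap.add_apply,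
      LinearMap.smul_apply, LinearMap.sum_apply, h.cc, h.central_left, add_zero,
      Fin.sum_univ_castSucc, this, Fin.val_last, h.last]
  have hw : b (presMap k c w ι x) (w 0) = x.1 • ι X.t + x.2.1 0 • ι X.s := by
    have : ∀ i : Fin k, b (w (i.succ : Fin (k + 1))) (w 0) = 0 :=
      fun i => h.left_zero _ (by simp) (by simp)
    simp only [presMap_apply, map_add, map_smul, map_sum, LinearMap.add_apply,
      LinearMap.smul_apply, LinearMap.sum_apply, h.cw, h.central_left, add_zero,
      Fin.sum_univ_succ, this, Fin.val_zero, h.ww, smul_zero, Finset.sum_const_zero]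
  rw [hr, hc, hw, presMap_apply, model_apply]
  simp only [zero_smul, zero_add, Pi.smul_apply, Fin.sum_univ_succ, shift_zero_apply,
    shift_succ_apply, smul_eq_mul, Fin.val_succ, map_add, map_smul, smul_add, mul_smul,
    ← Finset.smul_sum]
  rw [smul_comm x.1 y.1, smul_comm x.1 (y.2.1 0), smul_comm (x.2.1 0) (y.2.1 0)]
  abel

theorem Presents.isomorphic {b : Mult E} {X : Datum V} {c : E} {w : ℕ → E} {ι : V →ₗ[ℂ] E}
    (h : Presents b X k c w ι) (hb : Function.Bijective (presMap k c w ι)) :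
    Isomorphic (model k X) b :=
  ⟨LinearEquiv.ofBijective _ hb, h.presMap_mul⟩

theorem Presents.isomorphic_of_span [FiniteDimensional ℂ E] [FiniteDimensional ℂ V]
    {b : Mult E} {X : Datum V} {c : E} {w : ℕ → E} {ι : V →ₗ[ℂ] E}
    (h : Presents b X k c w ι)
    (hE : Module.finrank ℂ E = k + 2 + Module.finrank ℂ V)
    (hs : ∀ N : Submodule ℂ E, c ∈ N → (∀ i ≤ k, w i ∈ N) → (∀ v, ι v ∈ N) → N = ⊤) :
    Isomorphic (model k X) b := by
  have hsurj : Function.Surjective (presMap k c w ι) := by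
    rw [← LinearMap.range_eq_top]
    refine hs _ ⟨mc, presMap_mc c w ι⟩ (fun i hi => ⟨mw ⟨i, by omega⟩, presMap_mw c w ι _⟩)
      (fun v => ⟨mv v, presMap_mv c w ι v⟩)
  refine h.isomorphic ⟨?_, hsurj⟩
  refine (LinearMap.injective_iff_surjective_of_finrank_eq_finrank ?_).2 hsurj
  rw [hE]
  simp [Module.finrank_prod]
  ring

/-- In a Leibniz algebra the two annihilation conditions of `Presents` are automatic. -/
theorem Presents.of_isLeibniz {b : Mult E} (hb : IsLeibniz b) {X : Datum V} {c : E} {w : ℕ → E}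
    {ι : V →ₗ[ℂ] E} (hl : ∀ v x, b (ι v) x = 0) (hr : ∀ v x, b x (ι v) = 0)
    (hcc : b c c = ι X.u) (hcw : b c (w 0) = ι X.t) (hww : b (w 0) (w 0) = ι X.s)
    (hstep : ∀ i < k, b (w i) c = w (i + 1)) (hlast : b (w k) c = ι X.q) :
    Presents b X k c w ι := by
  -- Right multiplications by `c` and `w 0` commute because `[c, w 0]` is central. As `w (i + 1) =
  -- [w i, c]`, both annihilation conditions follow from this by induction.
  have hcomm : ∀ x, b (b x c) (w 0) = b (b x (w 0)) c := fun x => by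
    have := hb x c (w 0)
    rw [hcw, hr] at this
    exact (sub_eq_zero.1 this.symm)
  refine ⟨hl, hr, hcc, hcw, hww, hstep, hlast, ?_, ?_⟩
  · intro x i hi
    induction i, hi using Nat.le_induction generalizing x with
    | base =>
      intro hk
      rw [← hstep 0 (by omega), hb, hcomm, sub_self]
    | succ i hi ih =>
      intro hk
      rw [← hstep i (by omega), hb, ih _ (by omega), ih _ (by omega)]
      simp
  · intro i hi
    induction i, hi using Nat.le_induction with
    | base =>
      intro hk
      rw [← hstep 0 (by omega), hcomm, hww, hl]
    | succ i hi ih =>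
      intro hk
      rw [← hstep i (by omega), hcomm, ih (by omega)]
      simp

end Presentation

/-! ### Transport of the notions along isomorphisms. -/

section Isomorphism

variable {E E' E'' : Type*} [AddCommGroup E] [Module ℂ E] [AddCommGroup E'] [Module ℂ E']
  [AddCommGroup E''] [Module ℂ E'']

theorem Isomorphic.symm {b : Mult E} {b' : Mult E'} (h : Isomorphic b b') : Isomorphic b' b := by
  obtain ⟨φ, hφ⟩ := h
  exact ⟨φ.symm, fun x y => φ.injective (by simp [hφ])⟩

theorem Isomorphic.trans {b : Mult E} {b' : Mult E'} {b'' : Mult E''} (h : Isomorphic b b')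
    (h' : Isomorphic b' b'') : Isomorphic b b'' := by
  obtain ⟨φ, hφ⟩ := h
  obtain ⟨ψ, hψ⟩ := h'
  exact ⟨φ.trans ψ, fun x y => by simp [hφ, hψ]⟩

theorem IsLeibniz.of_isomorphic {b : Mult E} {b' : Mult E'} (h : Isomorphic b b')
    (hb : IsLeibniz b) : IsLeibniz b' := by
  obtain ⟨φ, hφ⟩ := h.symm
  intro x y z
  apply φ.injective
  simpa [hφ] using hb (φ x) (φ y) (φ z)

theorem IsCentralExtension.of_isomorphic {L : Type*} [AddCommGroup L] [Module ℂ L] {r : ℕ}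
    {bL : Mult L} {b : Mult E} {b' : Mult E'} (h : Isomorphic b b')
    (hb : IsCentralExtension r bL b) : IsCentralExtension r bL b' := by
  refine ⟨hb.1.of_isomorphic h, ?_⟩
  obtain ⟨φ, hφ⟩ := h
  obtain ⟨-, ε, π, hε, hπ, hex, hmul, hc⟩ := hb
  have hφ' : ∀ x y, φ.symm (b' x y) = b (φ.symm x) (φ.symm y) := fun x y =>
    φ.injective (by simp [hφ])
  refine ⟨φ.toLinearMap ∘ₗ ε, π ∘ₗ φ.symm.toLinearMap, ?_, ?_, ?_, ?_, ?_⟩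
  · exact φ.injective.comp hε
  · exact hπ.comp φ.symm.surjective
  · rw [LinearMap.range_comp, hex, LinearMap.ker_comp]
    exact Submodule.map_equiv_eq_comap_symm φ _
  · intro x y
    simp [hφ', hmul]
  · intro v x
    have h1 := hφ (ε v) (φ.symm x)
    have h2 := hφ (φ.symm x) (ε v)
    rw [(hc _ _).1] at h1
    rw [(hc _ _).2] at h2
    simp only [map_zero, LinearEquiv.apply_symm_apply] at h1 h2
    exact ⟨h1.symm, h2.symm⟩

theorem IsCentralExtension.of_isomorphic_base {L L' : Type*} [AddCommGroup L] [Module ℂ L]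
    [AddCommGroup L'] [Module ℂ L'] {r : ℕ} {bL : Mult L} {bL' : Mult L'} {b : Mult E}
    (h : Isomorphic bL bL') (hb : IsCentralExtension r bL b) : IsCentralExtension r bL' b := by
  obtain ⟨φ, hφ⟩ := h
  obtain ⟨hL, ε, π, hε, hπ, hex, hmul, hc⟩ := hb
  refine ⟨hL, ε, φ.toLinearMap ∘ₗ π, hε, φ.surjective.comp hπ, ?_, ?_, hc⟩
  · rw [hex, LinearEquiv.ker_comp]
  · intro x y
    simp [hφ, hmul]

theorem IsSplit.of_isomorphic {b : Mult E} {b' : Mult E'} (h : Isomorphic b b')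
    (hb : IsSplit b) : IsSplit b' := by
  obtain ⟨φ, hφ⟩ := h
  have key : ∀ I : Submodule ℂ E, IsIdeal b I → IsIdeal b' (I.map φ.toLinearMap) := by
    rintro I hI _ ⟨x, hx, rfl⟩ y
    obtain ⟨y, rfl⟩ := φ.surjective y
    exact ⟨⟨_, (hI x hx y).1, hφ x y⟩, ⟨_, (hI x hx y).2, hφ y x⟩⟩
  obtain ⟨I, J, hI, hJ, hI0, hJ0, hIJ⟩ := hb
  refine ⟨_, _, key I hI, key J hJ, ?_, ?_, ?_⟩
  · rwa [Ne, Submodule.map_eq_bot_iff]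
  · rwa [Ne, Submodule.map_eq_bot_iff]
  · exact hIJ.map (Submodule.orderIsoMapComap φ)

end Isomorphism

/-! ### Algebras given by tables, and central extensions of F_n^1 as models. -/

section Table

variable {m : ℕ} {t : ℕ → ℕ → (Fin m → ℂ)}

theorem eq_top_of_forall_e_mem {N : Submodule ℂ (Fin m → ℂ)}
    (h : ∀ i, 1 ≤ i → i ≤ m → e i ∈ N) : N = ⊤ := by
  rw [eq_top_iff, ← (Pi.basisFun ℂ (Fin m)).span_eq, Submodule.span_le]
  rintro _ ⟨i, rfl⟩
  rw [← e_succ_eq_basisFun]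
  exact h _ (by omega) (by omega)

theorem ofTable_right_eq_zero {j : ℕ} (hj : 1 ≤ j) (hjm : j ≤ m)
    (h : ∀ i, 1 ≤ i → i ≤ m → t i j = 0) (x : Fin m → ℂ) : ofTable m t x (e j) = 0 := by
  have : (ofTable m t).flip (e j) = 0 := by
    refine (Pi.basisFun ℂ (Fin m)).ext fun i => ?_
    rw [← e_succ_eq_basisFun, LinearMap.flip_apply, ofTable_e t (by omega) (by omega) hj hjm,
      h _ (by omega) (by omega)]
    rfl
  exact LinearMap.congr_fun this x

theorem ofTable_left_eq_zero {i : ℕ} (hi : 1 ≤ i) (him : i ≤ m)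
    (h : ∀ j, 1 ≤ j → j ≤ m → t i j = 0) (x : Fin m → ℂ) : ofTable m t (e i) x = 0 := by
  have : ofTable m t (e i) = 0 := by
    refine (Pi.basisFun ℂ (Fin m)).ext fun j => ?_
    rw [← e_succ_eq_basisFun, ofTable_e t hi him (by omega) (by omega),
      h _ (by omega) (by omega)]
    rfl
  exact LinearMap.congr_fun this x

end Table

theorem model_isomorphic_algF1 (k : ℕ) (hk : 1 ≤ k) :
    Isomorphic (model k (⟨0, 0, 0, 0⟩ : Datum (Fin 0 → ℂ))) (algF1 (k + 2)) := by
  have hz : ∀ x j, 2 ≤ j → j ≤ k + 2 → algF1 (k + 2) x (e j) = 0 := fun x j hj hjk =>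
    ofTable_right_eq_zero (by omega) hjk (fun i _ _ => by
      rw [if_neg (by omega), if_neg (by omega)]) x
  have h1 : algF1 (k + 2) (e 1) (e 1) = e 3 := by
    rw [algF1, ofTable_e _ le_rfl (by omega) le_rfl (by omega), if_pos (by omega)]
  have h2 : ∀ i, 2 ≤ i → i + 1 ≤ k + 2 → algF1 (k + 2) (e i) (e 1) = e (i + 1) := fun i hi hik => by
    rw [algF1, ofTable_e _ (by omega) (by omega) le_rfl (by omega), if_neg (by omega),
      if_pos (by omega)]
  have h3 : algF1 (k + 2) (e (k + 2)) (e 1) = 0 := by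
    rw [algF1, ofTable_e _ (by omega) (by omega) le_rfl (by omega), if_neg (by omega),
      if_neg (by omega)]
  -- Both `e 1` and `e 2` are sent to `e 3` by right multiplication by `e 1`, so their difference
  -- squares to zero.
  refine Presents.isomorphic_of_span (c := e 1 - e 2) (w := fun i => e (i + 2)) (ι := 0)
    ⟨by simp, by simp, ?_, ?_, ?_, ?_, ?_, ?_, ?_⟩ (by simp) ?_
  · simp [h1, h2 2 le_rfl (by omega), hz _ 2 le_rfl (by omega)]
  · simp [hz _ 2 le_rfl (by omega)]
  · simp [hz _ 2 le_rfl (by omega)]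
  · intro i hi
    simp [h2 (i + 2) (by omega) (by omega), hz _ 2 le_rfl (by omega)]
  · simp [h3, hz _ 2 le_rfl (by omega)]
  · intro x i _ hik
    exact hz x _ (by omega) (by omega)
  · intro i _ hik
    exact hz _ _ (by omega) (by omega)
  · intro N hc hw _
    refine eq_top_of_forall_e_mem fun i hi hik => ?_
    rcases hi.eq_or_lt with rfl | hi
    · simpa using N.add_mem hc (hw 0 (by omega))
    · obtain ⟨j, rfl⟩ := Nat.exists_eq_add_of_le' hi
      exact hw j (by omega)

theorem model_isCentralExtension {r k : ℕ} (hk : 1 ≤ k) (X : Datum (Fin r → ℂ)) :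
    IsCentralExtension r (algF1 (k + 2)) (model k X) := by
  refine IsCentralExtension.of_isomorphic_base (model_isomorphic_algF1 k hk) ?_
  refine ⟨model_isLeibniz X, mv,
    (LinearMap.fst ℂ _ _).prod
      (((LinearMap.fst ℂ _ _) ∘ₗ (LinearMap.snd ℂ _ _)).prod 0), ?_, ?_, ?_, ?_, ?_⟩
  · intro v v' h
    simpa using h
  · rintro ⟨x, y, z⟩
    exact ⟨(x, y, 0), by simp [Subsingleton.elim z 0]⟩
  · ext ⟨x, y, z⟩
    simp [eq_comm]
  · intro x y
    simp [model_apply]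
  · exact fun v x => ⟨model_mv_left X v x, model_mv_right X v x⟩

/-- Choosing lifts of `c` and `w_0` only, and iterating right multiplication by `c`, absorbs the
cocycle freedom in `[w_i, c]` for `i < k`. The four remaining products lie over zero, hence in the
image of `V`. -/
theorem IsCentralExtension.exists_model_isomorphic {r k : ℕ} (hk : 1 ≤ k) {E : Type*}
    [AddCommGroup E] [Module ℂ E] {b : Mult E}
    (h : IsCentralExtension r (algF1 (k + 2)) b) :
    ∃ X : Datum (Fin r → ℂ), Isomorphic (model k X) b := by
  have h' := h.of_isomorphic_base (model_isomorphic_algF1 k hk).symm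
  set X₀ : Datum (Fin 0 → ℂ) := ⟨0, 0, 0, 0⟩
  obtain ⟨hb, ε, π, hε, hπ, hex, hmul, hcen⟩ := h'
  obtain ⟨c, hc⟩ := hπ mc
  obtain ⟨d, hd⟩ := hπ (mw 0)
  have hker : ∀ x, π x = 0 → ∃ v, ε v = x := fun x hx => by
    have : x ∈ LinearMap.range ε := by rw [hex]; exact hx
    exact this
  have hπε : ∀ v, π (ε v) = 0 := fun v => by
    have : ε v ∈ LinearMap.ker π := by rw [← hex]; exact ⟨v, rfl⟩
    exact this
  set w : ℕ → E := fun i => (fun x => b x c)^[i] d with hwdef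
  have hstep : ∀ i, b (w i) c = w (i + 1) := fun i => by
    simp only [hwdef, Function.iterate_succ_apply']
  have hw : ∀ i (hi : i < k + 1), π (w i) = mw ⟨i, hi⟩ := by
    intro i
    induction i with
    | zero => exact fun _ => hd
    | succ i ih =>
      intro hi
      rw [← hstep, hmul, ih (by omega), hc]
      exact model_mw_castSucc_mc X₀ ⟨i, by omega⟩
  have hmv : ∀ v : Fin 0 → ℂ, (mv v : Carrier k (Fin 0 → ℂ)) = 0 := fun v => by
    rw [Subsingleton.elim v 0, map_zero]
  obtain ⟨u, hu⟩ := hker (b c c) (by rw [hmul, hc, model_mc_mc, hmv])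
  obtain ⟨t, ht⟩ := hker (b c d) (by rw [hmul, hc, hd, model_mc_mw, hmv])
  obtain ⟨s, hs⟩ := hker (b d d) (by rw [hmul, hd, model_mw_mw, hmv])
  obtain ⟨q, hq⟩ := hker (b (w k) c) (by
    rw [hmul, hw k (by omega), hc]
    exact (model_mw_last_mc X₀).trans (hmv _))
  have P : Presents b ⟨u, t, s, q⟩ k c w ε :=
    Presents.of_isLeibniz hb (fun v x => (hcen v x).1) (fun v x => (hcen v x).2)
      hu.symm ht.symm hs.symm (fun i _ => hstep i) hq.symm
  -- The comparison map covers the identity of the base and restricts to `ε` on the centre, so it is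
  -- bijective as in the five lemma.
  have hπP : ∀ x, π (presMap k c w ε x) = (x.1, x.2.1, 0) := fun x => by
    rw [carrier_decomp (x.1, x.2.1, (0 : Fin 0 → ℂ)), presMap_apply]
    simp only [map_add, map_smul, map_sum, hc, hπε, map_zero]
    congr 2
    exact Finset.sum_congr rfl fun i _ => by rw [hw i i.2]
  refine ⟨_, P.isomorphic ⟨?_, ?_⟩⟩
  · rw [injective_iff_map_eq_zero]
    intro x hx
    have := hπP x
    rw [hx, map_zero] at this
    obtain ⟨x0, xw, xv⟩ := x
    simp only [Prod.ext_iff, Prod.fst_zero, Prod.snd_zero, and_true] at this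
    obtain ⟨rfl, rfl⟩ := this
    have h0 := presMap_mv (k := k) c w ε xv
    rw [mv_apply, hx] at h0
    rw [hε (h0.symm.trans (map_zero ε).symm)]
    rfl
  · intro y
    obtain ⟨v, hv⟩ := hker (y - presMap k c w ε ((π y).1, (π y).2.1, 0)) (by
      rw [map_sub, hπP, sub_eq_zero]
      exact Prod.ext rfl (Prod.ext rfl (Subsingleton.elim _ _)))
    refine ⟨((π y).1, (π y).2.1, 0) + mv v, ?_⟩
    rw [map_add, presMap_mv, hv]
    abel

/-! ### Non-splitness and isomorphism in terms of structure constants. -/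

section Classification

variable {V : Type*} [AddCommGroup V] [Module ℂ V] {k : ℕ}

/-- The structure constants span the vector space. -/
def Datum.Spans (X : Datum V) : Prop :=
  ∀ N : Submodule ℂ V, X.u ∈ N → X.t ∈ N → X.s ∈ N → X.q ∈ N → N = ⊤

/-- A complement in `V` of a proper subspace containing `u, t, s, q` is a central ideal and splits
off. -/
theorem Datum.spans_of_not_isSplit {X : Datum V} (h : ¬ IsSplit (model k X)) : X.Spans := by
  intro N hu ht hs hq
  by_contra hN
  obtain ⟨J, hJ⟩ := exists_isCompl N
  refine h ⟨(⊤ : Submodule ℂ ℂ).prod ((⊤ : Submodule ℂ (Fin (k + 1) → ℂ)).prod N),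
    (⊥ : Submodule ℂ ℂ).prod ((⊥ : Submodule ℂ (Fin (k + 1) → ℂ)).prod J), ?_, ?_, ?_, ?_, ?_⟩
  · have : ∀ x y, (model k X x y).2.2 ∈ N := fun x y =>
      N.add_mem (N.add_mem (N.add_mem (N.smul_mem _ hq) (N.smul_mem _ hu)) (N.smul_mem _ ht))
        (N.smul_mem _ hs)
    intro x _ y
    simp [Submodule.mem_prod, this]
  · rintro ⟨x0, xw, xv⟩ hx y
    simp only [Submodule.mem_prod, Submodule.mem_bot] at hx
    obtain ⟨rfl, rfl, -⟩ := hx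
    rw [← mv_apply, model_mv_left, model_mv_right]
    exact ⟨Submodule.zero_mem _, Submodule.zero_mem _⟩
  · intro h0
    have : (mc : Carrier k V) ∈ (⊥ : Submodule ℂ (Carrier k V)) := by
      rw [← h0]
      simp [Submodule.mem_prod, mc]
    simp [mc] at this
  · intro h0
    apply hN
    have : J = ⊥ := by
      rw [eq_bot_iff]
      intro v hv
      have : (mv v : Carrier k V) ∈ (⊥ : Submodule ℂ (Carrier k V)) := by
        rw [← h0]
        simpa [Submodule.mem_prod] using hv
      simpa using this
    rw [this] at hJ
    simpa using hJ.sup_eq_top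
  · refine ⟨?_, ?_⟩
    · rw [disjoint_iff, Submodule.prod_inf_prod, Submodule.prod_inf_prod, hJ.inf_eq_bot]
      simp
    · rw [codisjoint_iff, Submodule.prod_sup_prod, Submodule.prod_sup_prod, hJ.sup_eq_top]
      simp

/-- If the structure constants span and `model k X = I ⊕ J` as ideals, where `I` has an element with
nonzero coefficient at `c`, then `J = 0`. -/
theorem eq_bot_of_isCompl (hk : 1 ≤ k) {X : Datum V} (hX : X.Spans)
    {I J : Submodule ℂ (Carrier k V)} (hI : IsIdeal (model k X) I) (hJ : IsIdeal (model k X) J)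
    (hIJ : IsCompl I J) {y : Carrier k V} (hy : y ∈ I) (hy0 : y.1 ≠ 0) : J = ⊥ := by
  have hann : ∀ x ∈ I, ∀ z ∈ J, model k X x z = 0 ∧ model k X z x = 0 := by
    intro x hx z hz
    constructor
    · exact Submodule.disjoint_def.1 hIJ.disjoint _ (hI x hx z).1 (hJ z hz x).2
    · exact Submodule.disjoint_def.1 hIJ.disjoint _ (hI x hx z).2 (hJ z hz x).1
  have hdec : ∀ z, ∃ x ∈ I, ∃ z' ∈ J, x + z' = z := fun z =>
    Submodule.mem_sup.1 (by rw [hIJ.sup_eq_top]; trivial)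
  -- From `[z, y] = 0` with `y.1 ≠ 0`, the shift kills `z`: of the `w`-coordinates only the one at
  -- `w_k` survives.
  have hJw : ∀ z ∈ J, ∀ i : Fin k, z.2.1 i.castSucc = 0 := by
    intro z hz i
    have := congrFun (congrArg (fun x => x.2.1) (hann y hy z hz).2) i.succ
    simpa [model_apply, hy0] using this
  have hJw0 : ∀ z ∈ J, z.2.1 0 = 0 := fun z hz => hJw z hz ⟨0, hk⟩
  -- Otherwise `I` would lose its `w_0`-coordinate by the same argument, and `I + J` could not
  -- contain `w_0`.
  have hJc : ∀ z ∈ J, z.1 = 0 := by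
    intro z hz
    by_contra hz0
    have hIw : ∀ x ∈ I, x.2.1 0 = 0 := by
      intro x hx
      have := model_apply_succ X x z ⟨0, hk⟩
      rw [(hann x hx z hz).1] at this
      simpa [hz0] using this
    obtain ⟨x, hx, z', hz', hxz⟩ := hdec (mw 0)
    have := congrArg (fun x => x.2.1 0) hxz
    simp [mw, hIw x hx, hJw0 z' hz'] at this
  have hJcen : ∀ z ∈ J, ∀ x, model k X z x = 0 ∧ model k X x z = 0 := by
    intro z hz x
    have hq : z.2.1 (Fin.last k) • X.q = 0 := by
      have := congrArg (fun x => x.2.2) (hann y hy z hz).2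
      simpa [model_apply, hJc z hz, hJw0 z hz, mul_smul, hy0] using this
    have hsh : shift z.2.1 = 0 := by
      funext i
      induction i using Fin.cases with
      | zero => rfl
      | succ i => simp [hJw z hz]
    constructor
    · simp [model_apply, hJc z hz, hJw0 z hz, mul_smul, hq, hsh]
    · simp [model_apply, hJc z hz, hJw0 z hz]
  -- Since `J` is central, all products come from `I`. Hence `I` contains `V`, by the spanning
  -- hypothesis, and also `w_k`; these contain `J`.
  have hprod : ∀ x x', model k X x x' ∈ I := by
    intro x x'
    obtain ⟨x, hx, z, hz, rfl⟩ := hdec x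
    rw [map_add, LinearMap.add_apply, (hJcen z hz x').1, add_zero]
    exact (hI x hx x').1
  have hVI : ∀ v, (mv v : Carrier k V) ∈ I := by
    have : I.comap mv = ⊤ := hX _
      (by rw [Submodule.mem_comap, ← model_mc_mc]; exact hprod _ _)
      (by rw [Submodule.mem_comap, ← model_mc_mw]; exact hprod _ _)
      (by rw [Submodule.mem_comap, ← model_mw_mw]; exact hprod _ _)
      (by rw [Submodule.mem_comap, ← model_mw_last_mc]; exact hprod _ _)
    intro v
    have hv : v ∈ I.comap mv := by rw [this]; trivial
    exact hv
  rw [eq_bot_iff]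
  intro z hz
  refine Submodule.disjoint_def.1 hIJ.disjoint _ ?_ hz
  rw [carrier_decomp z, hJc z hz, Fin.sum_univ_castSucc]
  obtain ⟨j, rfl⟩ := Nat.exists_eq_add_of_le' hk
  simp only [zero_smul, hJw z hz, Finset.sum_const_zero, zero_add]
  refine I.add_mem (I.smul_mem _ ?_) (hVI _)
  rw [← Fin.succ_last, ← model_mw_castSucc_mc X]
  exact hprod _ _

theorem Datum.Spans.not_isSplit (hk : 1 ≤ k) {X : Datum V} (hX : X.Spans) :
    ¬ IsSplit (model k X) := by
  rintro ⟨I, J, hI, hJ, hI0, hJ0, hIJ⟩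
  obtain ⟨x, hx, z, hz, hxz⟩ : ∃ x ∈ I, ∃ z ∈ J, x + z = (mc : Carrier k V) :=
    Submodule.mem_sup.1 (by rw [hIJ.sup_eq_top]; trivial)
  have h1 : x.1 + z.1 = 1 := congrArg Prod.fst hxz
  by_cases hx0 : x.1 = 0
  · refine hI0 (eq_bot_of_isCompl hk hX hJ hI hIJ.symm hz ?_)
    rw [hx0, zero_add] at h1
    simp [h1]
  · exact hJ0 (eq_bot_of_isCompl hk hX hI hJ hIJ hx hx0)

/-- Equivalence of structure constants under the automorphisms of the base algebra. -/
def Datum.Equivalent {V' : Type*} [AddCommGroup V'] [Module ℂ V'] (k : ℕ) (X : Datum V)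
    (X' : Datum V') : Prop :=
  ∃ (g : V ≃ₗ[ℂ] V') (a d τ : ℂ), a ≠ 0 ∧ d ≠ 0 ∧ g X.u = (a ^ 2) • X'.u + τ • X'.q ∧
    g X.t = (a * d) • X'.t ∧ g X.s = (d ^ 2) • X'.s ∧ g X.q = (a ^ (k + 1) * d) • X'.q

theorem Datum.Equivalent.isomorphic (hk : 1 ≤ k) {V' : Type*} [AddCommGroup V'] [Module ℂ V']
    {X : Datum V} {X' : Datum V'} (h : X.Equivalent k X') :
    Isomorphic (model k X) (model k X') := by
  obtain ⟨g, a, d, τ, ha, hd, hu, ht, hs, hq⟩ := h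
  set ι : V →ₗ[ℂ] Carrier k V' := mv ∘ₗ g.toLinearMap with hι
  -- The `w_k` term contributes `a * (τ / a) = τ` times `q` to `[c, c]` and disturbs no other
  -- product.
  set c : Carrier k V' := a • mc + (τ / a) • mw (Fin.last k) with hc
  set w : ℕ → Carrier k V' := fun i => (a ^ i * d) • mw (Fin.ofNat (k + 1) i) with hw
  have hlast0 : (0 : Fin (k + 1)) ≠ Fin.last k := by
    rw [Ne, Fin.ext_iff]
    simp
    omega
  have h0 : w 0 = d • mw 0 := by simp [hw]
  have hk' : w k = (a ^ k * d) • mw (Fin.last k) := by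
    simp only [hw]
    congr
    ext
    simp
  have hof : ∀ i (hi : i < k), Fin.ofNat (k + 1) i = (⟨i, hi⟩ : Fin k).castSucc := by
    intro i hi
    ext
    simp
    omega
  have hofs : ∀ i (hi : i < k), Fin.ofNat (k + 1) (i + 1) = (⟨i, hi⟩ : Fin k).succ := by
    intro i hi
    ext
    simp
    omega
  have hmw : ∀ (i : Fin (k + 1)) (j : Fin (k + 1)), j ≠ 0 → model k X' (mw i) (mw j) = 0 := by
    intro i j hj
    simp [model_apply, mw, hj.symm]
  have P : Presents (model k X') X k c w ι := by
    refine Presents.of_isLeibniz (model_isLeibniz X') (fun v x => model_mv_left X' _ x)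
      (fun v x => model_mv_right X' _ x) ?_ ?_ ?_ ?_ ?_
    · simp only [hc, map_add, map_smul, LinearMap.add_apply, LinearMap.smul_apply, model_mc_mc,
        model_mw_last_mc, hmw _ _ hlast0.symm, hι, LinearMap.comp_apply, LinearEquiv.coe_coe, hu]
      have : model k X' mc (mw (Fin.last k)) = 0 := by
        simp [model_apply, mw, mc, hlast0]
      rw [this]
      simp only [smul_zero, add_zero, smul_add, smul_smul, mul_div_cancel₀ _ ha, sq]
    · rw [h0, hc]
      have : model k X' (mw (Fin.last k)) (mw 0) = 0 := by
        simp [model_apply, mw, hlast0]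
      simp only [map_add, map_smul, LinearMap.add_apply, LinearMap.smul_apply, model_mc_mw, this,
        hι, LinearMap.comp_apply, LinearEquiv.coe_coe, ht, smul_zero, add_zero, smul_smul]
      rw [mul_comm]
    · rw [h0]
      simp only [map_smul, LinearMap.smul_apply, model_mw_mw, smul_smul, hι, LinearMap.comp_apply,
        LinearEquiv.coe_coe, hs]
      rw [sq]
    · intro i hi
      simp only [hw, hc, map_add, map_smul, LinearMap.smul_apply, hmw _ _ hlast0.symm, smul_zero,
        add_zero, hof i hi, hofs i hi, model_mw_castSucc_mc, smul_smul]
      congr 1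
      ring
    · rw [hk']
      simp only [hc, map_add, map_smul, LinearMap.smul_apply, hmw _ _ hlast0.symm, smul_zero,
        add_zero, model_mw_last_mc, smul_smul, hι, LinearMap.comp_apply, LinearEquiv.coe_coe, hq]
      congr 1
      ring
  have hval : ∀ x, presMap k c w ι x = (a * x.1, fun i : Fin (k + 1) => a ^ (i : ℕ) * d * x.2.1 i +
      (if i = Fin.last k then τ / a * x.1 else 0), g x.2.2) := by
    intro x
    refine Prod.ext ?_ (Prod.ext ?_ ?_)
    · simp [presMap_apply, hc, hw, hι, mc, mw, Prod.fst_sum, mul_comm]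
    · funext i
      simp [presMap_apply, hc, hw, hι, mc, mw, Prod.fst_sum, Prod.snd_sum, Finset.sum_apply,
        Pi.single_apply]
      split_ifs <;> ring
    · simp [presMap_apply, hc, hw, hι, mc, mw, Prod.snd_sum]
  refine P.isomorphic ⟨?_, ?_⟩
  · rw [injective_iff_map_eq_zero]
    intro x hx
    rw [hval] at hx
    simp only [Prod.ext_iff, Prod.fst_zero, Prod.snd_zero, mul_eq_zero, ha, false_or,
      LinearEquiv.map_eq_zero_iff] at hx
    obtain ⟨hx1, hx2, hx3⟩ := hx
    refine Prod.ext hx1 (Prod.ext ?_ hx3)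
    funext i
    simpa [hx1, ha, hd] using congrFun hx2 i
  · intro y
    refine ⟨(y.1 / a, fun i : Fin (k + 1) => (y.2.1 i - if i = Fin.last k then τ / a * (y.1 / a) else 0) /
      (a ^ (i : ℕ) * d), g.symm y.2.2), ?_⟩
    rw [hval]
    refine Prod.ext ?_ (Prod.ext ?_ ?_)
    · field_simp
    · funext i
      dsimp only
      field_simp
      split_ifs <;> ring
    · simp

/-- An isomorphism `φ` is triangular: `φ c` has no `w_0`-coordinate and `φ w_0` has no
`c`-coordinate. Its diagonal entries are `a` and `d`, and the `w_k`-coordinate of `φ c` produces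
`τ`. -/
theorem Datum.equivalent_of_isomorphic [FiniteDimensional ℂ V] (hk : 2 ≤ k) {X X' : Datum V}
    (hX' : X'.Spans) (h : Isomorphic (model k X) (model k X')) : X.Equivalent k X' := by
  obtain ⟨φ, hφ⟩ := h
  have hcen : ∀ v, (φ (mv v)).1 = 0 ∧ ∀ i : Fin k, (φ (mv v)).2.1 i.castSucc = 0 := by
    intro v
    have h1 : model k X' (φ (mv v)) mc = 0 := by
      obtain ⟨x, hx⟩ := φ.surjective mc
      rw [← hx, ← hφ, model_mv_left, map_zero]
    have h2 : model k X' (mw 0) (φ (mv v)) = 0 := by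
      obtain ⟨x, hx⟩ := φ.surjective (mw 0)
      rw [← hx, ← hφ, model_mv_right, map_zero]
    constructor
    · have := model_apply_succ X' (mw 0) (φ (mv v)) ⟨0, by omega⟩
      rw [h2] at this
      simpa [mw] using this.symm
    · intro i
      have := congrFun (congrArg (fun x => x.2.1) h1) i.succ
      simpa [model_apply, mc] using this
  have hzero : (0 : Fin (k + 1)) = (⟨0, by omega⟩ : Fin k).castSucc := rfl
  have hcen0 : ∀ v, (φ (mv v)).2.1 0 = 0 := fun v => by
    rw [hzero]
    exact (hcen v).2 _
  have hone : (⟨1, by omega⟩ : Fin k).castSucc = (⟨0, by omega⟩ : Fin k).succ := rfl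
  -- The left side is the `w_1`-coordinate of a central element, which vanishes because `k ≥ 2`
  -- makes `w_1` differ from `w_k`.
  have hprod1 : ∀ x y v, model k X x y = mv v → (φ y).1 * (φ x).2.1 0 = 0 := by
    intro x y v hxy
    have := (hcen v).2 ⟨1, by omega⟩
    rwa [← hxy, hφ, hone, model_apply_succ] at this
  have hcc := hprod1 _ _ _ (model_mc_mc X)
  have hcw := hprod1 _ _ _ (model_mc_mw X)
  have hww := hprod1 _ _ _ (model_mw_mw X)
  have hws : ∀ i : Fin k, φ (mw i.succ) = model k X' (φ (mw i.castSucc)) (φ mc) := fun i => by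
    rw [← model_mw_castSucc_mc X, hφ]
  -- Used on the `c`- and `w_0`-coordinates: neither can vanish on the image of every basis element,
  -- as `φ` is onto.
  have hlin : ∀ l : Carrier k V →ₗ[ℂ] ℂ, l (φ mc) = 0 → l (φ (mw 0)) = 0 →
      (∀ i : Fin k, l (φ (mw i.succ)) = 0) → (∀ v, l (φ (mv v)) = 0) → l = 0 := by
    intro l h1 h2 h3 h4
    refine LinearMap.ext fun y => ?_
    obtain ⟨x, rfl⟩ := φ.surjective y
    rw [carrier_decomp x, Fin.sum_univ_succ]
    simp [h1, h2, h3, -mv_apply, h4]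
  have hB : (φ mc).2.1 0 = 0 := by
    by_contra hB
    have := hlin (LinearMap.fst ℂ _ _) (by simpa [hB] using hcc) (by simpa [hB] using hcw)
      (fun i => by rw [hws]; rfl) (fun v => (hcen v).1)
    simpa [mc] using LinearMap.congr_fun this mc
  have hD : (φ (mw 0)).2.1 0 ≠ 0 := by
    intro hD
    have := hlin (LinearMap.proj 0 ∘ₗ LinearMap.fst ℂ _ _ ∘ₗ LinearMap.snd ℂ _ _)
      hB hD (fun i => by rw [hws]; simp [model_apply]) (fun v => hcen0 v)
    simpa [mw] using LinearMap.congr_fun this (mw 0)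
  have hC : (φ (mw 0)).1 = 0 := by simpa [hD] using hww
  have hA : (φ mc).1 ≠ 0 := by
    intro hA
    have := hlin (LinearMap.fst ℂ _ _) hA hC (fun i => by rw [hws]; rfl) (fun v => (hcen v).1)
    simpa [mc] using LinearMap.congr_fun this mc
  have hwdiag : ∀ i : Fin (k + 1),
      (φ (mw i)).1 = 0 ∧ (φ (mw i)).2.1 i = (φ mc).1 ^ (i : ℕ) * (φ (mw 0)).2.1 0 := by
    intro i
    induction i using Fin.induction with
    | zero => simp [hC]
    | succ i ih =>
      rw [hws]
      simp [model_apply, ih.2, pow_succ]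
      ring
  -- Projection to `V` is needed: `φ` need not preserve `V`, since `w_k` is central when `q = 0`.
  -- Bijectivity of `g` is recovered below from the spanning of `X'`.
  set g : V →ₗ[ℂ] V := LinearMap.snd ℂ _ _ ∘ₗ LinearMap.snd ℂ _ _ ∘ₗ φ.toLinearMap ∘ₗ mv with hg
  have hgv : ∀ v, g v = (φ (mv v)).2.2 := fun v => rfl
  have hu : g X.u = ((φ mc).1 ^ 2) • X'.u + ((φ mc).1 * (φ mc).2.1 (Fin.last k)) • X'.q := by
    rw [hgv, ← model_mc_mc, hφ, model_apply]
    simp [hB]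
    module
  have ht : g X.t = ((φ mc).1 * (φ (mw 0)).2.1 0) • X'.t := by
    rw [hgv, ← model_mc_mw, hφ, model_apply]
    simp [hC, hB]
  have hs : g X.s = ((φ (mw 0)).2.1 0 ^ 2) • X'.s := by
    rw [hgv, ← model_mw_mw, hφ, model_apply]
    simp [hC, sq]
  have hq : g X.q = ((φ mc).1 ^ (k + 1) * (φ (mw 0)).2.1 0) • X'.q := by
    rw [hgv, ← model_mw_last_mc, hφ, model_apply]
    simp [hB, (hwdiag (Fin.last k)).1, (hwdiag (Fin.last k)).2, pow_succ]
    congr 1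
    ring
  have hsurj : LinearMap.range g = ⊤ := by
    have key : ∀ (v : V) (z : ℂ), z ≠ 0 → z • v ∈ LinearMap.range g → v ∈ LinearMap.range g :=
      fun v z hz hv => (Submodule.smul_mem_iff _ hz).1 hv
    have hqr := key X'.q _ (mul_ne_zero (pow_ne_zero (k + 1) hA) hD) ⟨_, hq⟩
    refine hX' _ (key _ _ (pow_ne_zero 2 hA) ?_) (key _ _ (mul_ne_zero hA hD) ⟨_, ht⟩)
      (key _ _ (pow_ne_zero 2 hD) ⟨_, hs⟩) hqr
    rw [eq_sub_of_add_eq hu.symm]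
    exact Submodule.sub_mem _ ⟨_, rfl⟩ (Submodule.smul_mem _ _ hqr)
  have hbij : Function.Bijective g :=
    ⟨LinearMap.injective_iff_surjective.2 (LinearMap.range_eq_top.1 hsurj),
      LinearMap.range_eq_top.1 hsurj⟩
  exact ⟨LinearEquiv.ofBijective g hbij, _, _, _, hA, hD, hu, ht, hs, hq⟩

end Classification

/-! ### Vectors in the plane and their 2×2 minors. -/

section Plane

/-- The determinant of two vectors in the plane. -/
def det₂ (a b : Fin 2 → ℂ) : ℂ := a 0 * b 1 - a 1 * b 0

theorem det₂_self (a : Fin 2 → ℂ) : det₂ a a = 0 := by simp only [det₂]; ring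

theorem det₂_comm (a b : Fin 2 → ℂ) : det₂ a b = -det₂ b a := by simp only [det₂]; ring

theorem det₂_map (g : (Fin 2 → ℂ) →ₗ[ℂ] (Fin 2 → ℂ)) (a b : Fin 2 → ℂ) :
    det₂ (g a) (g b) = det₂ (g (Pi.single 0 1)) (g (Pi.single 1 1)) * det₂ a b := by
  have h : ∀ v : Fin 2 → ℂ, g v = v 0 • g (Pi.single 0 1) + v 1 • g (Pi.single 1 1) := by
    intro v
    rw [← map_smul, ← map_smul, ← map_add]
    congr 1
    funext i
    fin_cases i <;> simp
  rw [h a, h b]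
  simp only [det₂, Pi.add_apply, Pi.smul_apply, smul_eq_mul]
  ring

theorem cramer (a b v : Fin 2 → ℂ) (h : det₂ a b ≠ 0) :
    v = (det₂ v b / det₂ a b) • a + (det₂ a v / det₂ a b) • b := by
  funext i
  simp only [Pi.add_apply, Pi.smul_apply, smul_eq_mul]
  field_simp
  simp only [det₂]
  fin_cases i <;> simp <;> ring

/-- By Cramer's rule, the coordinates of each vector in the basis `x i, x j` are ratios of minors,
so proportional minors give equal coordinates. -/
theorem exists_linearEquiv_of_det₂ {ι : Type*} {x x' : ι → (Fin 2 → ℂ)} {δ : ℂ} (hδ : δ ≠ 0)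
    (h : ∀ i j, δ * det₂ (x i) (x j) = det₂ (x' i) (x' j)) {i j : ι} (hij : det₂ (x i) (x j) ≠ 0) :
    ∃ g : (Fin 2 → ℂ) ≃ₗ[ℂ] (Fin 2 → ℂ), ∀ l, g (x l) = x' l := by
  have hij' : det₂ (x' i) (x' j) ≠ 0 := by
    rw [← h]
    exact mul_ne_zero hδ hij
  let g : (Fin 2 → ℂ) →ₗ[ℂ] (Fin 2 → ℂ) :=
    { toFun := fun v => (det₂ v (x j) / det₂ (x i) (x j)) • x' i
        + (det₂ (x i) v / det₂ (x i) (x j)) • x' j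
      map_add' := fun v v' => by
        simp only [det₂, Pi.add_apply]
        module
      map_smul' := fun a v => by
        simp only [det₂, Pi.smul_apply, smul_eq_mul, RingHom.id_apply]
        module }
  have hg : ∀ v, g v = (det₂ v (x j) / det₂ (x i) (x j)) • x' i
        + (det₂ (x i) v / det₂ (x i) (x j)) • x' j := fun v => rfl
  have hinj : Function.Injective g := by
    rw [injective_iff_map_eq_zero]
    intro v hv
    rw [hg] at hv
    have h0 := congrFun hv 0
    have h1 := congrFun hv 1
    simp only [Pi.add_apply, Pi.smul_apply, smul_eq_mul, Pi.zero_apply] at h0 h1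
    have hA : (det₂ v (x j) / det₂ (x i) (x j)) * det₂ (x' i) (x' j) = 0 := by
      simp only [det₂] at h0 h1 ⊢
      linear_combination (x' j 1) * h0 - (x' j 0) * h1
    have hB : (det₂ (x i) v / det₂ (x i) (x j)) * det₂ (x' i) (x' j) = 0 := by
      simp only [det₂] at h0 h1 ⊢
      linear_combination (x' i 0) * h1 - (x' i 1) * h0
    rw [cramer _ _ v hij, (mul_eq_zero.1 hA).resolve_right hij',
      (mul_eq_zero.1 hB).resolve_right hij']
    simp
  refine ⟨LinearEquiv.ofInjectiveEndo g hinj, fun l => ?_⟩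
  rw [LinearEquiv.coe_ofInjectiveEndo, hg, cramer _ _ (x' l) hij', ← h, ← h, ← h,
    mul_div_mul_left _ _ hδ, mul_div_mul_left _ _ hδ]

/-- The four structure constants as a family. -/
def Datum.family {V : Type*} (X : Datum V) : Fin 4 → V := ![X.u, X.t, X.s, X.q]

theorem Datum.Spans.exists_det₂_ne_zero {X : Datum (Fin 2 → ℂ)} (hX : X.Spans) :
    ∃ i j, det₂ (X.family i) (X.family j) ≠ 0 := by
  by_contra! h
  have hz : ∀ i, X.family i = 0 := by
    intro i
    let N : Submodule ℂ (Fin 2 → ℂ) :=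
      { carrier := {v | det₂ (X.family i) v = 0}
        add_mem' := fun {v v'} hv hv' => by
          simp only [Set.mem_ofPred_eq, det₂, Pi.add_apply] at *
          linear_combination hv + hv'
        zero_mem' := by simp [det₂]
        smul_mem' := fun a v hv => by
          simp only [Set.mem_ofPred_eq, det₂, Pi.smul_apply, smul_eq_mul] at *
          linear_combination a * hv }
    have hN : N = ⊤ := hX N (h i 0) (h i 1) (h i 2) (h i 3)
    have hall : ∀ v, det₂ (X.family i) v = 0 := fun v => by
      have : v ∈ N := by rw [hN]; trivial
      exact this
    have h0 := hall (Pi.single 0 1)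
    have h1 := hall (Pi.single 1 1)
    simp only [det₂, Pi.single_apply] at h0 h1
    funext l
    fin_cases l
    · simpa using h1
    · simpa using h0
  exact bot_ne_top (hX ⊥ (hz 0) (hz 1) (hz 2) (hz 3))

theorem Datum.spans_of_det₂_ne_zero {X : Datum (Fin 2 → ℂ)} {i j : Fin 4}
    (h : det₂ (X.family i) (X.family j) ≠ 0) : X.Spans := by
  intro N hu ht hs hq
  have hmem : ∀ l, X.family l ∈ N := by
    intro l
    fin_cases l
    exacts [hu, ht, hs, hq]
  rw [eq_top_iff]
  intro v _
  rw [cramer _ _ v h]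
  exact N.add_mem (N.smul_mem _ (hmem i)) (N.smul_mem _ (hmem j))

theorem Datum.plucker (X : Datum (Fin 2 → ℂ)) :
    det₂ X.q X.u * det₂ X.t X.s - det₂ X.q X.t * det₂ X.u X.s + det₂ X.q X.s * det₂ X.u X.t = 0 := by
  simp only [det₂]
  ring

end Plane

/-! ### A complete set of invariants for equivalence. -/

section Invariants

/-- Numbers with the same vanishing differ by a nonzero factor. -/
theorem exists_ratio {a b : ℂ} (h : a = 0 ↔ b = 0) : ∃ r, r ≠ 0 ∧ a = r * b := by
  by_cases hb : b = 0
  · exact ⟨1, one_ne_zero, by simp [hb, h.2 hb]⟩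
  · exact ⟨a / b, div_ne_zero (fun ha => hb (h.1 ha)) hb, by field_simp⟩

/-- The invariants of the structure constants agree. -/
structure Datum.Same (X X' : Datum (Fin 2 → ℂ)) : Prop where
  qt : det₂ X.q X.t = 0 ↔ det₂ X'.q X'.t = 0
  qs : det₂ X.q X.s = 0 ↔ det₂ X'.q X'.s = 0
  qu : det₂ X.q X.u = 0 ↔ det₂ X'.q X'.u = 0
  ts : det₂ X.t X.s = 0 ↔ det₂ X'.t X'.s = 0
  inv : det₂ X.q X.s * det₂ X.q X.u * det₂ X'.q X'.t ^ 2 =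
    det₂ X'.q X'.s * det₂ X'.q X'.u * det₂ X.q X.t ^ 2
  ut : det₂ X.q X.t = 0 → det₂ X.q X.s = 0 → (det₂ X.u X.t = 0 ↔ det₂ X'.u X'.t = 0)
  us : det₂ X.q X.t = 0 → det₂ X.q X.s = 0 → (det₂ X.u X.s = 0 ↔ det₂ X'.u X'.s = 0)
  inv' : det₂ X.q X.t = 0 → det₂ X.q X.s = 0 →
    det₂ X.u X.t * det₂ X.t X.s * det₂ X'.u X'.s ^ 2 =
      det₂ X'.u X'.t * det₂ X'.t X'.s * det₂ X.u X.s ^ 2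

theorem Datum.Equivalent.same {k : ℕ} {X X' : Datum (Fin 2 → ℂ)} (h : X.Equivalent k X') :
    X.Same X' := by
  obtain ⟨g, a, d, τ, ha, hd, hu, ht, hs, hq⟩ := h
  set δ := det₂ (g (Pi.single 0 1)) (g (Pi.single 1 1)) with hδ
  have hdet : ∀ x y, det₂ (g x) (g y) = δ * det₂ x y := fun x y => det₂_map g.toLinearMap x y
  have hδ0 : δ ≠ 0 := by
    intro h0
    have := hdet (g.symm (Pi.single 0 1)) (g.symm (Pi.single 1 1))
    rw [h0, zero_mul, g.apply_symm_apply, g.apply_symm_apply] at this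
    simp [det₂] at this
  have e1 : δ * det₂ X.u X.t = a ^ 3 * d * det₂ X'.u X'.t + τ * a * d * det₂ X'.q X'.t := by
    rw [← hdet, hu, ht]
    simp only [det₂, Pi.add_apply, Pi.smul_apply, smul_eq_mul]
    ring
  have e2 : δ * det₂ X.u X.s = a ^ 2 * d ^ 2 * det₂ X'.u X'.s + τ * d ^ 2 * det₂ X'.q X'.s := by
    rw [← hdet, hu, hs]
    simp only [det₂, Pi.add_apply, Pi.smul_apply, smul_eq_mul]
    ring
  have e3 : δ * det₂ X.t X.s = a * d ^ 3 * det₂ X'.t X'.s := by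
    rw [← hdet, ht, hs]
    simp only [det₂, Pi.smul_apply, smul_eq_mul]
    ring
  have e4 : δ * det₂ X.q X.t = a ^ (k + 2) * d ^ 2 * det₂ X'.q X'.t := by
    rw [← hdet, hq, ht]
    simp only [det₂, Pi.smul_apply, smul_eq_mul]
    ring
  have e5 : δ * det₂ X.q X.s = a ^ (k + 1) * d ^ 3 * det₂ X'.q X'.s := by
    rw [← hdet, hq, hs]
    simp only [det₂, Pi.smul_apply, smul_eq_mul]
    ring
  have e6 : δ * det₂ X.q X.u = a ^ (k + 3) * d * det₂ X'.q X'.u := by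
    rw [← hdet, hq, hu]
    simp only [det₂, Pi.add_apply, Pi.smul_apply, smul_eq_mul]
    ring
  have iff_of : ∀ {z p p' : ℂ}, z ≠ 0 → δ * p = z * p' → (p = 0 ↔ p' = 0) := by
    intro z p p' hz hp
    constructor
    · rintro rfl
      simpa [hz] using hp.symm
    · rintro rfl
      simpa [hδ0] using hp
  have h4 := iff_of (by simp [ha, hd]) e4
  have h5 := iff_of (by simp [ha, hd]) e5
  refine ⟨h4, h5, iff_of (by simp [ha, hd]) e6, iff_of (by simp [ha, hd]) e3, ?_, ?_, ?_, ?_⟩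
  · have hz : δ ^ 2 * (a ^ (k + 2) * d ^ 2) ^ 2 ≠ 0 := by simp [ha, hd, hδ0]
    apply mul_left_cancel₀ hz
    calc _ = (δ * det₂ X.q X.s) * (δ * det₂ X.q X.u)
            * (a ^ (k + 2) * d ^ 2 * det₂ X'.q X'.t) ^ 2 := by ring
      _ = _ := by
        rw [e5, e6, ← e4]
        ring
  · intro h h'
    rw [h4] at h
    rw [h, mul_zero, add_zero] at e1
    exact iff_of (by simp [ha, hd]) e1
  · intro h h'
    rw [h5] at h'
    rw [h', mul_zero, add_zero] at e2
    exact iff_of (by simp [ha, hd]) e2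
  · intro h h'
    rw [h4] at h
    rw [h5] at h'
    rw [h, mul_zero, add_zero] at e1
    rw [h', mul_zero, add_zero] at e2
    have hz : δ ^ 2 * (a ^ 2 * d ^ 2) ^ 2 ≠ 0 := by simp [ha, hd, hδ0]
    apply mul_left_cancel₀ hz
    calc _ = (δ * det₂ X.u X.t) * (δ * det₂ X.t X.s)
            * (a ^ 2 * d ^ 2 * det₂ X'.u X'.s) ^ 2 := by ring
      _ = _ := by
        rw [e1, e3, ← e2]
        ring

/-- A torus acting on triples with weights in geometric progression has the vanishing pattern and
`p₁ p₃ / p₂²` as its only invariants. A square root is taken only when the middle entry vanishes. -/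
theorem exists_torus_of_inv {p₁ p₂ p₃ p₁' p₂' p₃' : ℂ} (h₁ : p₁ = 0 ↔ p₁' = 0)
    (h₂ : p₂ = 0 ↔ p₂' = 0) (h₃ : p₃ = 0 ↔ p₃' = 0)
    (h : p₁ * p₃ * p₂' ^ 2 = p₁' * p₃' * p₂ ^ 2) :
    ∃ δ x, δ ≠ 0 ∧ x ≠ 0 ∧ p₁ = δ * p₁' ∧ p₂ = δ * x * p₂' ∧ p₃ = δ * x ^ 2 * p₃' := by
  obtain ⟨r₁, hr₁, e₁⟩ := exists_ratio h₁
  obtain ⟨r₂, hr₂, e₂⟩ := exists_ratio h₂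
  obtain ⟨r₃, hr₃, e₃⟩ := exists_ratio h₃
  by_cases hp₂ : p₂' = 0
  · have : p₂ = 0 := h₂.2 hp₂
    obtain ⟨z, hz⟩ := IsAlgClosed.exists_pow_nat_eq (r₃ / r₁) (n := 2) (by norm_num)
    refine ⟨r₁, z, hr₁, ?_, e₁, by simp [this, hp₂], ?_⟩
    · rintro rfl
      exact div_ne_zero hr₃ hr₁ (by rw [← hz]; norm_num)
    · rw [hz, e₃]
      field_simp
  by_cases hp₁ : p₁' = 0
  · have : p₁ = 0 := h₁.2 hp₁
    refine ⟨r₂ ^ 2 / r₃, r₃ / r₂, by positivity, by positivity, by simp [this, hp₁], ?_, ?_⟩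
    · rw [e₂]
      field_simp
    · rw [e₃]
      field_simp
  · refine ⟨r₁, r₂ / r₁, hr₁, by positivity, e₁, ?_, ?_⟩
    · rw [e₂]
      field_simp
    · rw [e₁, e₂] at h
      have : r₁ * (p₁' * p₂' ^ 2) * p₃ = r₂ ^ 2 * p₃' * (p₁' * p₂' ^ 2) := by
        linear_combination h
      have : r₁ * p₃ = r₂ ^ 2 * p₃' := by
        apply mul_left_cancel₀ (mul_ne_zero hp₁ (pow_ne_zero 2 hp₂))
        linear_combination this
      field_simp
      linear_combination this

/-- Here `x` plays the role of `d / a`, `y` that of `a ^ k`, and `t` that of the rescaled `τ`. If QT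
or QS is nonzero, `t` adjusts one of UT, US and the Plücker relation forces the other. -/
theorem Datum.Same.exists_scalars {X X' : Datum (Fin 2 → ℂ)} (h : X.Same X') :
    ∃ δ x y t, δ ≠ 0 ∧ x ≠ 0 ∧ y ≠ 0 ∧
      det₂ X.u X.t = δ * (det₂ X'.u X'.t + t * det₂ X'.q X'.t) ∧
      det₂ X.u X.s = δ * x * (det₂ X'.u X'.s + t * det₂ X'.q X'.s) ∧
      det₂ X.t X.s = δ * x ^ 2 * det₂ X'.t X'.s ∧
      det₂ X.q X.t = δ * y * x * det₂ X'.q X'.t ∧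
      det₂ X.q X.s = δ * y * x ^ 2 * det₂ X'.q X'.s ∧
      det₂ X.q X.u = δ * y * det₂ X'.q X'.u := by
  obtain ⟨hqt, hqs, hqu, hts, hinv, hut, hus, hinv'⟩ := h
  have P := X.plucker
  have P' := X'.plucker
  generalize det₂ X.u X.t = UT at *
  generalize det₂ X.u X.s = US at *
  generalize det₂ X.t X.s = TS at *
  generalize det₂ X.q X.t = QT at *
  generalize det₂ X.q X.s = QS at *
  generalize det₂ X.q X.u = QU at *
  generalize det₂ X'.u X'.t = UT' at *
  generalize det₂ X'.u X'.s = US' at *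
  generalize det₂ X'.t X'.s = TS' at *
  generalize det₂ X'.q X'.t = QT' at *
  generalize det₂ X'.q X'.s = QS' at *
  generalize det₂ X'.q X'.u = QU' at *
  by_cases hQT : QT = 0
  · have hQT' := hqt.1 hQT
    subst hQT hQT'
    by_cases hQS : QS = 0
    · have hQS' := hqs.1 hQS
      subst hQS hQS'
      obtain ⟨δ, x, hδ, hx, h1, h2, h3⟩ :=
        exists_torus_of_inv (hut rfl rfl) (hus rfl rfl) hts (hinv' rfl rfl)
      obtain ⟨r, hr, h4⟩ := exists_ratio hqu
      refine ⟨δ, x, r / δ, 0, hδ, hx, div_ne_zero hr hδ, by simpa using h1, by simpa using h2, h3,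
        by simp, by simp, ?_⟩
      rw [h4]
      field_simp
    · have hQS' : QS' ≠ 0 := fun h => hQS (hqs.2 h)
      obtain ⟨r, hr, h1⟩ := exists_ratio hqs
      obtain ⟨r', hr', h2⟩ := exists_ratio hqu
      -- QS and QU scale by factors with quotient `x ^ 2`. The value of `t` below is solved from the
      -- equation for US.
      obtain ⟨x, hx⟩ := IsAlgClosed.exists_pow_nat_eq (r / r') (n := 2) (by norm_num)
      have hx0 : x ≠ 0 := by
        rintro rfl
        exact div_ne_zero hr hr' (by rw [← hx]; norm_num)
      obtain ⟨r'', hr'', h3⟩ := exists_ratio hts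
      have hr2 : r = r' * x ^ 2 := by
        rw [hx]
        field_simp
      refine ⟨r'' / x ^ 2, x, r' * x ^ 2 / r'', (US * x / r'' - US') / QS', by positivity, hx0,
        by positivity, ?_, ?_, ?_, by simp, ?_, ?_⟩
      · apply mul_left_cancel₀ hQS
        rw [mul_zero, add_zero]
        apply mul_left_cancel₀ (pow_ne_zero 2 hx0)
        have : QS * UT = -(QU * TS) := by linear_combination P
        rw [this, h1, h2, h3, hr2]
        field_simp
        linear_combination -P'
      · field_simp
        ring
      · rw [h3]
        field_simp
      · rw [h1, hr2]
        field_simp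
      · rw [h2]
        field_simp
  · have hQT' : QT' ≠ 0 := fun h => hQT (hqt.2 h)
    obtain ⟨r, hr, h1⟩ := exists_ratio hqt
    -- With QT nonzero, one of QS, QU fixes `x` and the invariant `QS * QU / QT ^ 2` makes the other
    -- agree. Then `t` is solved from the equation for UT.
    obtain ⟨x, hx, h2, h3⟩ : ∃ x, x ≠ 0 ∧ QS = r * x * QS' ∧ QU = r / x * QU' := by
      by_cases hQS : QS = 0
      · obtain ⟨r', hr', h2⟩ := exists_ratio hqu
        refine ⟨r / r', by positivity, by simp [hQS, hqs.1 hQS], ?_⟩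
        rw [h2]
        field_simp
      · obtain ⟨r', hr', h2⟩ := exists_ratio hqs
        refine ⟨r' / r, by positivity, by rw [h2]; field_simp, ?_⟩
        have hQS' : QS' ≠ 0 := fun h => hQS (hqs.2 h)
        rw [h1, h2] at hinv
        have : QU * r' = r ^ 2 * QU' := by
          apply mul_left_cancel₀ (mul_ne_zero hQS' (pow_ne_zero 2 hQT'))
          linear_combination hinv
        field_simp
        linear_combination this
    obtain ⟨r'', hr'', h4⟩ := exists_ratio hts
    refine ⟨r'' / x ^ 2, x, r * x / r'', (UT * x ^ 2 / r'' - UT') / QT', by positivity, hx,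
      by positivity, ?_, ?_, ?_, ?_, ?_, ?_⟩
    · field_simp
      ring
    · apply mul_left_cancel₀ hQT
      have : QT * US = QU * TS + QS * UT := by linear_combination -P
      rw [this, h1, h2, h3, h4]
      field_simp
      linear_combination (r'') * P'
    · rw [h4]
      field_simp
    · rw [h1]
      field_simp
    · rw [h2]
      field_simp
    · rw [h3]
      field_simp

theorem Datum.Same.equivalent {k : ℕ} (hk : 1 ≤ k) {X X' : Datum (Fin 2 → ℂ)} (hX : X.Spans)
    (h : X.Same X') : X.Equivalent k X' := by
  obtain ⟨δ, x, y, t, hδ, hx, hy, h1, h2, h3, h4, h5, h6⟩ := h.exists_scalars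
  -- Solves `y = a ^ k`; then `d = x * a`.
  obtain ⟨a, ha⟩ := IsAlgClosed.exists_pow_nat_eq y (n := k) hk
  have ha0 : a ≠ 0 := by
    rintro rfl
    exact hy (by rw [← ha, zero_pow (by omega)])
  obtain ⟨i, j, hij⟩ := hX.exists_det₂_ne_zero
  set Y : Datum (Fin 2 → ℂ) := ⟨(a ^ 2) • X'.u + (a ^ 2 * t) • X'.q, (a * (x * a)) • X'.t,
    ((x * a) ^ 2) • X'.s, (a ^ (k + 1) * (x * a)) • X'.q⟩ with hY
  -- The factor comes from UT, whose weight is `a ^ 3 * d = a ^ 4 * x`.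
  have hfam : ∀ i j, a ^ 4 * x / δ * det₂ (X.family i) (X.family j)
      = det₂ (Y.family i) (Y.family j) := by
    have e1 : a ^ 4 * x / δ * det₂ X.u X.t = det₂ Y.u Y.t := by
      rw [h1, ← mul_assoc, div_mul_cancel₀ _ hδ]
      simp only [hY, det₂, Pi.add_apply, Pi.smul_apply, smul_eq_mul]
      ring
    have e2 : a ^ 4 * x / δ * det₂ X.u X.s = det₂ Y.u Y.s := by
      rw [h2, mul_assoc δ, ← mul_assoc, div_mul_cancel₀ _ hδ]
      simp only [hY, det₂, Pi.add_apply, Pi.smul_apply, smul_eq_mul]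
      ring
    have e3 : a ^ 4 * x / δ * det₂ X.t X.s = det₂ Y.t Y.s := by
      rw [h3, mul_assoc δ, ← mul_assoc, div_mul_cancel₀ _ hδ]
      simp only [hY, det₂, Pi.smul_apply, smul_eq_mul]
      ring
    have e4 : a ^ 4 * x / δ * det₂ X.q X.t = det₂ Y.q Y.t := by
      rw [h4, mul_assoc δ, mul_assoc δ, ← mul_assoc, div_mul_cancel₀ _ hδ, ← ha]
      simp only [hY, det₂, Pi.smul_apply, smul_eq_mul]
      ring
    have e5 : a ^ 4 * x / δ * det₂ X.q X.s = det₂ Y.q Y.s := by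
      rw [h5, mul_assoc δ, mul_assoc δ, ← mul_assoc, div_mul_cancel₀ _ hδ, ← ha]
      simp only [hY, det₂, Pi.smul_apply, smul_eq_mul]
      ring
    have e6 : a ^ 4 * x / δ * det₂ X.q X.u = det₂ Y.q Y.u := by
      rw [h6, mul_assoc δ, ← mul_assoc, div_mul_cancel₀ _ hδ, ← ha]
      simp only [hY, det₂, Pi.add_apply, Pi.smul_apply, smul_eq_mul]
      ring
    have hsw : ∀ {p p' q q' : Fin 2 → ℂ}, a ^ 4 * x / δ * det₂ p q = det₂ p' q' →
        a ^ 4 * x / δ * det₂ q p = det₂ q' p' := by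
      intro p p' q q' h
      rw [det₂_comm q, det₂_comm q', ← h]
      ring
    have hsf : ∀ {p p' : Fin 2 → ℂ}, a ^ 4 * x / δ * det₂ p p = det₂ p' p' := by
      intro p p'
      rw [det₂_self, det₂_self, mul_zero]
    intro i j
    fin_cases i <;> fin_cases j
    exacts [hsf, e1, e2, hsw e6, hsw e1, hsf, e3, hsw e4, hsw e2, hsw e3, hsf, hsw e5, e6, e4, e5,
      hsf]
  obtain ⟨g, hg⟩ := exists_linearEquiv_of_det₂ (by positivity) hfam hij
  exact ⟨g, a, x * a, a ^ 2 * t, ha0, mul_ne_zero hx ha0, hg 0, hg 1, hg 2, hg 3⟩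

end Invariants

/-! ### The listed algebras as models. -/

variable {k : ℕ}

/-- The inclusion of the plane spanned by `x` and `y`. -/
def planeMap {E : Type*} [AddCommGroup E] [Module ℂ E] (x y : E) : (Fin 2 → ℂ) →ₗ[ℂ] E :=
  Fintype.linearCombination ℂ ![x, y]

theorem planeMap_apply {E : Type*} [AddCommGroup E] [Module ℂ E] (x y : E) (v : Fin 2 → ℂ) :
    planeMap x y v = v 0 • x + v 1 • y := by
  simp [planeMap, Fintype.linearCombination_apply, Fin.sum_univ_two]

/-- Structure constants of `algL`. -/
def datumL (α₃ α₄ β₃ β₄ : ℂ) : Datum (Fin 2 → ℂ) :=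
  ⟨![α₄ - α₃, β₄ - β₃ - 1], ![α₃ - α₄, β₃ - β₄], ![α₄, β₄], ![1, 0]⟩

/-- Structure constants of `algM`. -/
def datumM (α₄ β₄ : ℂ) : Datum (Fin 2 → ℂ) :=
  ⟨![α₄ - 1, β₄ - 1], ![-α₄, 1 - β₄], ![α₄, β₄], ![0, 0]⟩

/-- Structure constants of `algL1` (`ε = 0`) and `algLstar` (`ε = 1`). -/
def datumLstar (ε : ℂ) : Datum (Fin 2 → ℂ) :=
  ⟨![ε, 0], ![-ε, 0], ![ε, -1], ![1, 0]⟩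

theorem model_isomorphic_algL (hk : 2 ≤ k) (α₃ α₄ β₃ β₄ : ℂ) :
    Isomorphic (model k (datumL α₃ α₄ β₃ β₄)) (algL (k + 2) α₃ α₄ β₃ β₄) := by
  set b := algL (k + 2) α₃ α₄ β₃ β₄ with hb
  have hr : ∀ x j, 2 ≤ j → j ≤ k + 4 → j ≠ k + 3 → b x (e j) = 0 := fun x j hj hjk hj' =>
    ofTable_right_eq_zero (by omega) hjk (fun i _ _ => by
      rw [if_neg (by omega), if_neg (by omega), if_neg (by omega), if_neg (by omega)]) x
  have hl : ∀ x i, i = k + 2 ∨ i = k + 4 → b (e i) x = 0 := fun x i hi =>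
    ofTable_left_eq_zero (by omega) (by omega) (fun j _ _ => by
      rw [if_neg (by omega), if_neg (by omega), if_neg (by omega), if_neg (by omega)]) x
  have h1 : ∀ i, 1 ≤ i → i ≤ k + 1 → b (e i) (e 1) = e (i + 1) := fun i hi hik => by
    rw [hb, algL, ofTable_e _ hi (by omega) le_rfl (by omega), if_pos (by omega)]
  have h2 : b (e (k + 3)) (e 1) = e 2 + e (k + 4) := by
    rw [hb, algL, ofTable_e _ (by omega) (by omega) le_rfl (by omega), if_neg (by omega),
      if_pos (by omega)]
  have h3 : b (e 1) (e (k + 3)) = α₃ • e (k + 2) + β₃ • e (k + 4) := by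
    rw [hb, algL, ofTable_e _ (by omega) (by omega) (by omega) (by omega), if_neg (by omega),
      if_neg (by omega), if_pos (by omega)]
  have h4 : b (e (k + 3)) (e (k + 3)) = α₄ • e (k + 2) + β₄ • e (k + 4) := by
    rw [hb, algL, ofTable_e _ (by omega) (by omega) (by omega) (by omega), if_neg (by omega),
      if_neg (by omega), if_neg (by omega), if_pos (by omega)]
  have h5 : ∀ i, 2 ≤ i → i ≤ k + 2 → b (e i) (e (k + 3)) = 0 := fun i hi hik => by
    rw [hb, algL, ofTable_e _ (by omega) (by omega) (by omega) (by omega), if_neg (by omega),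
      if_neg (by omega), if_neg (by omega), if_neg (by omega)]
  have hr1 := fun x => hr x (k + 2) (by omega) (by omega) (by omega)
  have hr2 := fun x => hr x (k + 4) (by omega) (by omega) (by omega)
  have hl1 := fun x => hl x (k + 2) (by omega)
  have hl2 := fun x => hl x (k + 4) (by omega)
  -- `w 1` is forced to be `[w 0, c]`, which differs from `e 2` by a central term. From `w 2` on,
  -- the correction is killed.
  let w : ℕ → (Fin (k + 4) → ℂ)
    | 0 => e (k + 3)
    | 1 => e 2 + e (k + 4) - (α₄ • e (k + 2) + β₄ • e (k + 4))
    | i + 2 => e (i + 3)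
  refine Presents.isomorphic_of_span (c := e 1 - e (k + 3)) (w := w)
    (ι := planeMap (e (k + 2)) (e (k + 4))) ⟨?_, ?_, ?_, ?_, ?_, ?_, ?_, ?_, ?_⟩ (by simp) ?_
  · intro v x
    simp [planeMap_apply, hl1, hl2]
  · intro v x
    simp [planeMap_apply, hr1, hr2]
  · simp only [map_sub, LinearMap.sub_apply, h1 1 le_rfl (by omega), h2, h3, h4, planeMap_apply,
      datumL, Matrix.cons_val_zero, Matrix.cons_val_one]
    module
  · simp only [w, map_sub, LinearMap.sub_apply, h3, h4, planeMap_apply,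
      datumL, Matrix.cons_val_zero, Matrix.cons_val_one]
    module
  · simp only [w, h4, planeMap_apply, datumL, Matrix.cons_val_zero, Matrix.cons_val_one]
  · intro i hi
    match i with
    | 0 => simp only [w, map_sub, h2, h4]
    | 1 =>
      simp [w, h1 2 (by omega) (by omega), h5 2 (by omega) (by omega), hl1, hl2]
    | i + 2 =>
      simp [w, h1 (i + 3) (by omega) (by omega), h5 (i + 3) (by omega) (by omega)]
  -- Here `w k = e (k + 1)`, whose product with `c` is `e (k + 2)`, the first basis vector of the
  -- centre; hence `q = ![1, 0]`.
  · obtain ⟨j, rfl⟩ := Nat.exists_eq_add_of_le' hk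
    simp [w, h1 (j + 3) (by omega) (by omega), h5 (j + 3) (by omega) (by omega), planeMap_apply,
      datumL]
  · intro x i hi hik
    match i with
    | 1 => simp [w, hr _ 2 (by omega) (by omega) (by omega), hr1, hr2]
    | i + 2 => exact hr _ _ (by omega) (by omega) (by omega)
  · intro i hi hik
    match i with
    | 1 => simp [w, h5 2 (by omega) (by omega), hl1, hl2]
    | i + 2 => exact h5 _ (by omega) (by omega)
  · intro N hc hw hι
    have hv1 : e (k + 2) ∈ N := by simpa [planeMap_apply] using hι ![1, 0]
    have hv2 : e (k + 4) ∈ N := by simpa [planeMap_apply] using hι ![0, 1]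
    have hd : e (k + 3) ∈ N := hw 0 (by omega)
    refine eq_top_of_forall_e_mem fun i hi hik => ?_
    match i with
    | 1 => simpa using N.add_mem hc hd
    | 2 =>
      have := hw 1 (by omega)
      simp only [w] at this
      have := N.sub_mem (N.add_mem this (N.add_mem (N.smul_mem α₄ hv1) (N.smul_mem β₄ hv2))) hv2
      simpa using this
    | i + 3 =>
      rcases lt_or_ge i k with h | h
      · rcases eq_or_ne (i + 3) (k + 2) with h' | h'
        · rw [h']; exact hv1
        · exact hw (i + 2) (by omega)
      · obtain rfl | rfl : i = k ∨ i = k + 1 := by omega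
        exacts [hd, hv2]

theorem model_isomorphic_algM (hk : 2 ≤ k) (α₄ β₄ : ℂ) :
    Isomorphic (model k (datumM α₄ β₄)) (algM (k + 2) α₄ β₄) := by
  set b := algM (k + 2) α₄ β₄ with hb
  have hr : ∀ x j, 2 ≤ j → j ≤ k + 4 → j ≠ k + 2 → b x (e j) = 0 := fun x j hj hjk hj' =>
    ofTable_right_eq_zero (by omega) hjk (fun i _ _ => by
      rw [if_neg (by omega), if_neg (by omega), if_neg (by omega), if_neg (by omega)]) x
  have hl : ∀ x i, i = k + 3 ∨ i = k + 4 → b (e i) x = 0 := fun x i hi =>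
    ofTable_left_eq_zero (by omega) (by omega) (fun j _ _ => by
      rw [if_neg (by omega), if_neg (by omega), if_neg (by omega), if_neg (by omega)]) x
  have h1 : ∀ i, 1 ≤ i → i ≤ k → b (e i) (e 1) = e (i + 1) := fun i hi hik => by
    rw [hb, algM, ofTable_e _ hi (by omega) le_rfl (by omega), if_pos (by omega)]
  have h1' : b (e (k + 1)) (e 1) = 0 := by
    rw [hb, algM, ofTable_e _ (by omega) (by omega) le_rfl (by omega), if_neg (by omega),
      if_neg (by omega), if_neg (by omega), if_neg (by omega)]
  have h2 : b (e (k + 2)) (e 1) = e 2 + e (k + 3) := by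
    rw [hb, algM, ofTable_e _ (by omega) (by omega) le_rfl (by omega), if_neg (by omega),
      if_pos (by omega)]
  have h3 : b (e 1) (e (k + 2)) = e (k + 4) := by
    rw [hb, algM, ofTable_e _ (by omega) (by omega) (by omega) (by omega), if_neg (by omega),
      if_neg (by omega), if_pos (by omega)]
  have h4 : b (e (k + 2)) (e (k + 2)) = α₄ • e (k + 3) + β₄ • e (k + 4) := by
    rw [hb, algM, ofTable_e _ (by omega) (by omega) (by omega) (by omega), if_neg (by omega),
      if_neg (by omega), if_neg (by omega), if_pos (by omega)]
  have h5 : ∀ i, 2 ≤ i → i ≤ k + 1 → b (e i) (e (k + 2)) = 0 := fun i hi hik => by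
    rw [hb, algM, ofTable_e _ (by omega) (by omega) (by omega) (by omega), if_neg (by omega),
      if_neg (by omega), if_neg (by omega), if_neg (by omega)]
  have hr1 := fun x => hr x (k + 3) (by omega) (by omega) (by omega)
  have hr2 := fun x => hr x (k + 4) (by omega) (by omega) (by omega)
  have hl1 := fun x => hl x (k + 3) (by omega)
  have hl2 := fun x => hl x (k + 4) (by omega)
  let w : ℕ → (Fin (k + 4) → ℂ)
    | 0 => e (k + 2)
    | 1 => e 2 + e (k + 3) - (α₄ • e (k + 3) + β₄ • e (k + 4))
    | i + 2 => e (i + 3)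
  -- The chain now stops at `e (k + 1)`, so `q = 0`; the centre `V` is spanned by the last two basis
  -- vectors.
  refine Presents.isomorphic_of_span (c := e 1 - e (k + 2)) (w := w)
    (ι := planeMap (e (k + 3)) (e (k + 4))) ⟨?_, ?_, ?_, ?_, ?_, ?_, ?_, ?_, ?_⟩ (by simp) ?_
  · intro v x
    simp [planeMap_apply, hl1, hl2]
  · intro v x
    simp [planeMap_apply, hr1, hr2]
  · simp only [map_sub, LinearMap.sub_apply, h1 1 le_rfl (by omega), h2, h3, h4, planeMap_apply,
      datumM, Matrix.cons_val_zero, Matrix.cons_val_one]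
    module
  · simp only [w, map_sub, LinearMap.sub_apply, h3, h4, planeMap_apply,
      datumM, Matrix.cons_val_zero, Matrix.cons_val_one]
    module
  · simp only [w, h4, planeMap_apply, datumM, Matrix.cons_val_zero, Matrix.cons_val_one]
  · intro i hi
    match i with
    | 0 => simp only [w, map_sub, h2, h4]
    | 1 =>
      simp [w, h1 2 (by omega) (by omega), h5 2 (by omega) (by omega), hl1, hl2]
    | i + 2 =>
      simp [w, h1 (i + 3) (by omega) (by omega), h5 (i + 3) (by omega) (by omega)]
  · obtain ⟨j, rfl⟩ := Nat.exists_eq_add_of_le' hk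
    simp [w, h1', h5 (j + 3) (by omega) (by omega), planeMap_apply, datumM]
  · intro x i hi hik
    match i with
    | 1 => simp [w, hr _ 2 (by omega) (by omega) (by omega), hr1, hr2]
    | i + 2 => exact hr _ _ (by omega) (by omega) (by omega)
  · intro i hi hik
    match i with
    | 1 => simp [w, h5 2 (by omega) (by omega), hl1, hl2]
    | i + 2 => exact h5 _ (by omega) (by omega)
  · intro N hc hw hι
    have hv1 : e (k + 3) ∈ N := by simpa [planeMap_apply] using hι ![1, 0]
    have hv2 : e (k + 4) ∈ N := by simpa [planeMap_apply] using hι ![0, 1]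
    have hd : e (k + 2) ∈ N := hw 0 (by omega)
    refine eq_top_of_forall_e_mem fun i hi hik => ?_
    match i with
    | 1 => simpa using N.add_mem hc hd
    | 2 =>
      have := hw 1 (by omega)
      simp only [w] at this
      have := N.sub_mem (N.add_mem this (N.add_mem (N.smul_mem α₄ hv1) (N.smul_mem β₄ hv2))) hv1
      simpa using this
    | i + 3 =>
      rcases lt_or_ge i k with h | h
      · rcases eq_or_ne (i + 3) (k + 2) with h' | h'
        · rw [h']; exact hd
        · exact hw (i + 2) (by omega)
      · obtain rfl | rfl : i = k ∨ i = k + 1 := by omega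
        exacts [hv1, hv2]

/-- A common form of `algL1` (`ε = 0`) and `algLstar` (`ε = 1`). -/
theorem model_isomorphic_ofTable (hk : 2 ≤ k) (ε : ℂ) :
    Isomorphic (model k (datumLstar ε)) (ofTable (k + 4) fun i j =>
      if i ≤ k + 1 ∧ j = 1 then e (i + 1)
      else if i = 1 ∧ j = k + 3 then e 2 + e (k + 4)
      else if 2 ≤ i ∧ i ≤ k + 1 ∧ j = k + 3 then e (i + 1)
      else if i = k + 3 ∧ j = k + 3 then ε • e (k + 2)
      else 0) := by
  set b := ofTable (k + 4) _ with hb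
  have hr : ∀ x j, 2 ≤ j → j ≤ k + 4 → j ≠ k + 3 → b x (e j) = 0 := fun x j hj hjk hj' =>
    ofTable_right_eq_zero (by omega) hjk (fun i _ _ => by
      rw [if_neg (by omega), if_neg (by omega), if_neg (by omega), if_neg (by omega)]) x
  have hl : ∀ x i, i = k + 2 ∨ i = k + 4 → b (e i) x = 0 := fun x i hi =>
    ofTable_left_eq_zero (by omega) (by omega) (fun j _ _ => by
      rw [if_neg (by omega), if_neg (by omega), if_neg (by omega), if_neg (by omega)]) x
  have h1 : ∀ i, 1 ≤ i → i ≤ k + 1 → b (e i) (e 1) = e (i + 1) := fun i hi hik => by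
    rw [hb, ofTable_e _ hi (by omega) le_rfl (by omega), if_pos (by omega)]
  have h2 : b (e (k + 3)) (e 1) = 0 := by
    rw [hb, ofTable_e _ (by omega) (by omega) le_rfl (by omega), if_neg (by omega),
      if_neg (by omega), if_neg (by omega), if_neg (by omega)]
  have h3 : b (e 1) (e (k + 3)) = e 2 + e (k + 4) := by
    rw [hb, ofTable_e _ (by omega) (by omega) (by omega) (by omega), if_neg (by omega),
      if_pos (by omega)]
  have h4 : b (e (k + 3)) (e (k + 3)) = ε • e (k + 2) := by
    rw [hb, ofTable_e _ (by omega) (by omega) (by omega) (by omega), if_neg (by omega),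
      if_neg (by omega), if_neg (by omega), if_pos (by omega)]
  have h5 : ∀ i, 2 ≤ i → i ≤ k + 1 → b (e i) (e (k + 3)) = e (i + 1) := fun i hi hik => by
    rw [hb, ofTable_e _ (by omega) (by omega) (by omega) (by omega), if_neg (by omega),
      if_neg (by omega), if_pos (by omega)]
  have hr1 := fun x => hr x (k + 2) (by omega) (by omega) (by omega)
  have hr2 := fun x => hr x (k + 4) (by omega) (by omega) (by omega)
  have hl1 := fun x => hl x (k + 2) (by omega)
  have hl2 := fun x => hl x (k + 4) (by omega)
  clear_value b
  let w : ℕ → (Fin (k + 4) → ℂ)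
    | 0 => e 1 - e (k + 3)
    | 1 => e 2 + e (k + 4) - ε • e (k + 2)
    | i + 2 => e (i + 3)
  -- Right multiplications by `e 1` and `e (k + 3)` agree on `e 2, …, e (k + 1)`, so the difference
  -- of these two elements is taken as `w 0` and `e (k + 3)` acts as the shift.
  refine Presents.isomorphic_of_span (c := e (k + 3)) (w := w)
    (ι := planeMap (e (k + 2)) (e (k + 4))) ⟨?_, ?_, ?_, ?_, ?_, ?_, ?_, ?_, ?_⟩ (by simp) ?_
  · intro v x
    simp [planeMap_apply, hl1, hl2]
  · intro v x
    simp [planeMap_apply, hr1, hr2]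
  · simp [h4, planeMap_apply, datumLstar]
  · simp [w, h2, h4, planeMap_apply, datumLstar]
  · simp only [w, map_sub, LinearMap.sub_apply, h1 1 le_rfl (by omega), h2, h3, h4,
      planeMap_apply, datumLstar, Matrix.cons_val_zero, Matrix.cons_val_one]
    module
  · intro i hi
    match i with
    | 0 => simp only [w, map_sub, LinearMap.sub_apply, h3, h4]
    | 1 => simp [w, h5 2 (by omega) (by omega), hl1, hl2]
    | i + 2 => simp [w, h5 (i + 3) (by omega) (by omega)]
  · obtain ⟨j, rfl⟩ := Nat.exists_eq_add_of_le' hk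
    simp [w, h5 (j + 3) (by omega) (by omega), planeMap_apply, datumLstar]
  · intro x i hi hik
    match i with
    | 1 => simp [w, hr _ 2 (by omega) (by omega) (by omega), hr1, hr2]
    | i + 2 => exact hr _ _ (by omega) (by omega) (by omega)
  · intro i hi hik
    match i with
    | 1 => simp [w, h1 2 (by omega) (by omega), h5 2 (by omega) (by omega), hl1, hl2]
    | i + 2 =>
      rcases eq_or_ne (i + 3) (k + 2) with h' | h'
      · simp [w, h', hl1]
      · simp [w, h1 (i + 3) (by omega) (by omega), h5 (i + 3) (by omega) (by omega)]
  · intro N hc hw hι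
    have hv1 : e (k + 2) ∈ N := by simpa [planeMap_apply] using hι ![1, 0]
    have hv2 : e (k + 4) ∈ N := by simpa [planeMap_apply] using hι ![0, 1]
    have hd : e 1 - e (k + 3) ∈ N := hw 0 (by omega)
    refine eq_top_of_forall_e_mem fun i hi hik => ?_
    match i with
    | 1 => simpa using N.add_mem hd hc
    | 2 =>
      have := hw 1 (by omega)
      simp only [w] at this
      have := N.sub_mem (N.add_mem this (N.smul_mem ε hv1)) hv2
      simpa using this
    | i + 3 =>
      rcases lt_or_ge i k with h | h
      · rcases eq_or_ne (i + 3) (k + 2) with h' | h'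
        · rw [h']; exact hv1
        · exact hw (i + 2) (by omega)
      · obtain rfl | rfl : i = k ∨ i = k + 1 := by omega
        exacts [hc, hv2]

theorem algL5_eq_algL (l μ : ℂ) : algL5 (k + 2 + 2) l μ = algL (k + 2) 0 0 l μ := by
  unfold algL5 algL
  congr 1
  funext i j
  simp only [zero_smul, zero_add, add_comm (e 2) (e (k + 2 + 2) : Fin (k + 2 + 2) → ℂ)]
  congr 1
  · simp
  · congr 1
    · simp
    · congr 1
      · simp
      · simp

theorem model_isomorphic_algL1 (hk : 2 ≤ k) :
    Isomorphic (model k (datumLstar 0)) (algL1 (k + 2 + 2)) := by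
  convert model_isomorphic_ofTable hk 0 using 1
  unfold algL1
  congr 1
  funext i j
  simp only [zero_smul, ite_self]
  split_ifs <;> first | rfl | omega | exact add_comm _ _

theorem model_isomorphic_algLstar (hk : 2 ≤ k) :
    Isomorphic (model k (datumLstar 1)) (algLstar (k + 2)) := by
  convert model_isomorphic_ofTable hk 1 using 1
  unfold algLstar
  congr 1
  funext i j
  simp only [one_smul]
  split_ifs <;> first | rfl | omega

/-- Structure constants of the entries of the list. -/
def Entry.datum : Entry → Datum (Fin 2 → ℂ)
  | .L1000 => datumL 1 0 0 0
  | .L1100 => datumL 1 1 0 0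
  | .L0100 => datumL 0 1 0 0
  | .L0110 => datumL 0 1 1 0
  | .L100 β₄ _ => datumL 1 0 0 β₄
  | .L01neg10 => datumL 0 1 (-1) 0
  | .L0111 => datumL 0 1 1 1
  | .L0124 => datumL 0 1 2 4
  | .M1 β₄ _ => datumM 1 β₄
  | .M00 => datumM 0 0
  | .M01 => datumM 0 1
  | .M02 => datumM 0 2
  | .M21 => datumM 2 1
  | .M22 => datumM 2 2
  | .M11 => datumM 1 1
  | .quasi1 => datumLstar 0
  | .quasi3 l _ => datumL 0 0 l 0
  | .quasi4 l _ => datumL 0 0 0 l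
  | .quasi5 l μ _ => datumL 0 0 l μ
  | .Lstar => datumLstar 1

theorem Entry.model_isomorphic (hk : 2 ≤ k) (p : Entry) :
    Isomorphic (model k p.datum) (p.alg (k + 2)) := by
  have hL5 : ∀ l μ, Isomorphic (model k (datumL 0 0 l μ)) (algL5 (k + 2 + 2) l μ) := fun l μ => by
    rw [algL5_eq_algL]
    exact model_isomorphic_algL hk _ _ _ _
  match p with
  | .L1000 => exact model_isomorphic_algL hk _ _ _ _
  | .L1100 => exact model_isomorphic_algL hk _ _ _ _
  | .L0100 => exact model_isomorphic_algL hk _ _ _ _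
  | .L0110 => exact model_isomorphic_algL hk _ _ _ _
  | .L100 _ _ => exact model_isomorphic_algL hk _ _ _ _
  | .L01neg10 => exact model_isomorphic_algL hk _ _ _ _
  | .L0111 => exact model_isomorphic_algL hk _ _ _ _
  | .L0124 => exact model_isomorphic_algL hk _ _ _ _
  | .M1 _ _ => exact model_isomorphic_algM hk _ _
  | .M00 => exact model_isomorphic_algM hk _ _
  | .M01 => exact model_isomorphic_algM hk _ _
  | .M02 => exact model_isomorphic_algM hk _ _
  | .M21 => exact model_isomorphic_algM hk _ _
  | .M22 => exact model_isomorphic_algM hk _ _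
  | .M11 => exact model_isomorphic_algM hk _ _
  | .quasi1 => exact model_isomorphic_algL1 hk
  | .quasi3 l _ => exact hL5 l 0
  | .quasi4 l _ => exact hL5 0 l
  | .quasi5 l μ _ => exact hL5 l μ
  | .Lstar => exact model_isomorphic_algLstar hk

/-! ### Minors of the listed data. -/

section Determinants

variable (α₃ α₄ β₃ β₄ ε : ℂ)

theorem datumL_qt : det₂ (datumL α₃ α₄ β₃ β₄).q (datumL α₃ α₄ β₃ β₄).t = β₃ - β₄ := by
  simp [det₂, datumL]

theorem datumL_qs : det₂ (datumL α₃ α₄ β₃ β₄).q (datumL α₃ α₄ β₃ β₄).s = β₄ := by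
  simp [det₂, datumL]

theorem datumL_qu : det₂ (datumL α₃ α₄ β₃ β₄).q (datumL α₃ α₄ β₃ β₄).u = β₄ - β₃ - 1 := by
  simp [det₂, datumL]

theorem datumL_ut : det₂ (datumL α₃ α₄ β₃ β₄).u (datumL α₃ α₄ β₃ β₄).t = α₃ - α₄ := by
  simp [det₂, datumL]; ring

theorem datumL_us : det₂ (datumL α₃ α₄ β₃ β₄).u (datumL α₃ α₄ β₃ β₄).s =
    α₄ * (1 + β₃) - α₃ * β₄ := by
  simp [det₂, datumL]; ring

theorem datumL_ts : det₂ (datumL α₃ α₄ β₃ β₄).t (datumL α₃ α₄ β₃ β₄).s = α₃ * β₄ - α₄ * β₃ := by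
  simp [det₂, datumL]; ring

theorem datumM_qt : det₂ (datumM α₄ β₄).q (datumM α₄ β₄).t = 0 := by simp [det₂, datumM]

theorem datumM_qs : det₂ (datumM α₄ β₄).q (datumM α₄ β₄).s = 0 := by simp [det₂, datumM]

theorem datumM_qu : det₂ (datumM α₄ β₄).q (datumM α₄ β₄).u = 0 := by simp [det₂, datumM]

theorem datumM_ut : det₂ (datumM α₄ β₄).u (datumM α₄ β₄).t = β₄ - 1 := by
  simp [det₂, datumM]; ring

theorem datumM_us : det₂ (datumM α₄ β₄).u (datumM α₄ β₄).s = α₄ - β₄ := by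
  simp [det₂, datumM]; ring

theorem datumM_ts : det₂ (datumM α₄ β₄).t (datumM α₄ β₄).s = -α₄ := by
  simp [det₂, datumM]; ring

theorem datumLstar_qt : det₂ (datumLstar ε).q (datumLstar ε).t = 0 := by simp [det₂, datumLstar]

theorem datumLstar_qs : det₂ (datumLstar ε).q (datumLstar ε).s = -1 := by
  simp [det₂, datumLstar]

theorem datumLstar_qu : det₂ (datumLstar ε).q (datumLstar ε).u = 0 := by simp [det₂, datumLstar]

theorem datumLstar_ut : det₂ (datumLstar ε).u (datumLstar ε).t = 0 := by simp [det₂, datumLstar]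

theorem datumLstar_us : det₂ (datumLstar ε).u (datumLstar ε).s = -ε := by
  simp [det₂, datumLstar]

theorem datumLstar_ts : det₂ (datumLstar ε).t (datumLstar ε).s = ε := by
  simp [det₂, datumLstar]

/-- QT and QU add up to `-1`, so they cannot both vanish. -/
theorem datumL_spans : (datumL α₃ α₄ β₃ β₄).Spans := by
  by_cases h : β₃ - β₄ = 0
  · refine Datum.spans_of_det₂_ne_zero (i := 3) (j := 0) ((datumL_qu _ _ _ _).trans_ne ?_)
    intro h'
    have : (1 : ℂ) = 0 := by linear_combination -h - h'
    exact one_ne_zero this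
  · exact Datum.spans_of_det₂_ne_zero (i := 3) (j := 1) ((datumL_qt _ _ _ _).trans_ne h)

/-- UT, US and TS add up to `-1`. -/
theorem datumM_spans : (datumM α₄ β₄).Spans := by
  by_cases h : α₄ = 0
  · by_cases h' : β₄ - 1 = 0
    · refine Datum.spans_of_det₂_ne_zero (i := 0) (j := 2) ((datumM_us _ _).trans_ne ?_)
      rw [h, sub_eq_zero.1 h']
      norm_num
    · exact Datum.spans_of_det₂_ne_zero (i := 0) (j := 1) ((datumM_ut _ _).trans_ne h')
  · exact Datum.spans_of_det₂_ne_zero (i := 1) (j := 2)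
      ((datumM_ts _ _).trans_ne (neg_ne_zero.2 h))

theorem datumLstar_spans : (datumLstar ε).Spans :=
  Datum.spans_of_det₂_ne_zero (i := 3) (j := 2) ((datumLstar_qs _).trans_ne (by norm_num))

end Determinants

theorem Entry.datum_spans (p : Entry) : p.datum.Spans := by
  cases p <;> first
    | exact datumL_spans _ _ _ _
    | exact datumM_spans _ _
    | exact datumLstar_spans _

/-- The case tree follows the vanishing of QU, QT, QS, then of TS, UT, US; a parameter appears only
where one of the two ratios is a free nonzero number. -/
theorem Entry.exists_same {X : Datum (Fin 2 → ℂ)} (hX : X.Spans) :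
    ∃ p : Entry, X.Same p.datum := by
  have P := X.plucker
  by_cases hQU : det₂ X.q X.u = 0
  · by_cases hQT : det₂ X.q X.t = 0
    · by_cases hQS : det₂ X.q X.s = 0
      · by_cases hUT : det₂ X.u X.t = 0
        · by_cases hUS : det₂ X.u X.s = 0
          · have hTS : det₂ X.t X.s ≠ 0 := by
              intro hTS
              obtain ⟨i, j, hij⟩ := hX.exists_det₂_ne_zero
              apply hij
              have hsw : ∀ {a b}, det₂ a b = 0 → det₂ b a = 0 := fun h => by
                rw [det₂_comm, h, neg_zero]
              fin_cases i <;> fin_cases j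
              exacts [det₂_self _, hUT, hUS, hsw hQU, hsw hUT, det₂_self _, hTS, hsw hQT, hsw hUS,
                hsw hTS, det₂_self _, hsw hQS, hQU, hQT, hQS, det₂_self _]
            refine ⟨.M11, ?_⟩
            constructor <;> simp [Entry.datum, datumM_qt, datumM_qs, datumM_qu, datumM_ut,
              datumM_us, datumM_ts, *]
          · by_cases hTS : det₂ X.t X.s = 0
            · refine ⟨.M01, ?_⟩
              constructor <;> simp [Entry.datum, datumM_qt, datumM_qs, datumM_qu, datumM_ut,
                datumM_us, datumM_ts, *]
            · refine ⟨.M21, ?_⟩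
              constructor <;> norm_num [Entry.datum, datumM_qt, datumM_qs, datumM_qu, datumM_ut,
                datumM_us, datumM_ts, *]
        · by_cases hUS : det₂ X.u X.s = 0
          · by_cases hTS : det₂ X.t X.s = 0
            · refine ⟨.M00, ?_⟩
              constructor <;> simp [Entry.datum, datumM_qt, datumM_qs, datumM_qu, datumM_ut,
                datumM_us, datumM_ts, *]
            · refine ⟨.M22, ?_⟩
              constructor <;> norm_num [Entry.datum, datumM_qt, datumM_qs, datumM_qu, datumM_ut,
                datumM_us, datumM_ts, *]
          · by_cases hTS : det₂ X.t X.s = 0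
            · refine ⟨.M02, ?_⟩
              constructor <;> norm_num [Entry.datum, datumM_qt, datumM_qs, datumM_qu, datumM_ut,
                datumM_us, datumM_ts, *]
            -- For `datumM 1 (1 - z)` the minors UT, US, TS are `-z, z, -1`, so `US ^ 2 / (UT * TS)
            -- = z`.
            · set z := det₂ X.u X.s ^ 2 / (det₂ X.u X.t * det₂ X.t X.s) with hz
              have hz0 : z ≠ 0 := by positivity
              refine ⟨.M1 (1 - z) (by simpa using hz0), ?_⟩
              constructor <;> simp [Entry.datum, datumM_qt, datumM_qs, datumM_qu, datumM_ut,
                datumM_us, datumM_ts, hQU, hQT, hQS, hUT, hUS, hTS, hz0]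
              rw [hz]
              field_simp
      · by_cases hTS : det₂ X.t X.s = 0
        · refine ⟨.quasi1, ?_⟩
          constructor <;> norm_num [Entry.datum, datumLstar_qt, datumLstar_qs, datumLstar_qu, datumLstar_ut, datumLstar_us,
 datumLstar_ts, *]
        · refine ⟨.Lstar, ?_⟩
          constructor <;> norm_num [Entry.datum, datumLstar_qt, datumLstar_qs, datumLstar_qu, datumLstar_ut, datumLstar_us,
 datumLstar_ts, *]
    · by_cases hQS : det₂ X.q X.s = 0
      · by_cases hTS : det₂ X.t X.s = 0
        · refine ⟨.quasi3 (-1) (Or.inl rfl), ?_⟩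
          constructor <;> norm_num [Entry.datum, datumL_qt, datumL_qs, datumL_qu, datumL_ut, datumL_us, datumL_ts, *]
        · refine ⟨.L01neg10, ?_⟩
          constructor <;> norm_num [Entry.datum, datumL_qt, datumL_qs, datumL_qu, datumL_ut, datumL_us, datumL_ts, *]
      · by_cases hTS : det₂ X.t X.s = 0
        · refine ⟨.quasi4 1 one_ne_zero, ?_⟩
          constructor <;> norm_num [Entry.datum, datumL_qt, datumL_qs, datumL_qu, datumL_ut, datumL_us, datumL_ts, *]
        · refine ⟨.L100 1 one_ne_zero, ?_⟩
          constructor <;> norm_num [Entry.datum, datumL_qt, datumL_qs, datumL_qu, datumL_ut, datumL_us, datumL_ts, *]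
  · by_cases hQT : det₂ X.q X.t = 0
    · by_cases hQS : det₂ X.q X.s = 0
      -- With QT = QS = 0 the Plücker relation reduces to QU·TS = 0.
      · have hTS : det₂ X.t X.s = 0 := by
          simpa [hQT, hQS, hQU] using P
        by_cases hUT : det₂ X.u X.t = 0
        · by_cases hUS : det₂ X.u X.s = 0
          · refine ⟨.quasi3 0 (Or.inr (Or.inl rfl)), ?_⟩
            constructor <;> norm_num [Entry.datum, datumL_qt, datumL_qs, datumL_qu, datumL_ut, datumL_us, datumL_ts, *]
          · refine ⟨.L1100, ?_⟩
            constructor <;> norm_num [Entry.datum, datumL_qt, datumL_qs, datumL_qu, datumL_ut, datumL_us, datumL_ts, *]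
        · by_cases hUS : det₂ X.u X.s = 0
          · refine ⟨.L1000, ?_⟩
            constructor <;> norm_num [Entry.datum, datumL_qt, datumL_qs, datumL_qu, datumL_ut, datumL_us, datumL_ts, *]
          · refine ⟨.L0100, ?_⟩
            constructor <;> norm_num [Entry.datum, datumL_qt, datumL_qs, datumL_qu, datumL_ut, datumL_us, datumL_ts, *]
      · by_cases hTS : det₂ X.t X.s = 0
        · refine ⟨.quasi5 1 1 (Or.inl ⟨rfl, rfl⟩), ?_⟩
          constructor <;> norm_num [Entry.datum, datumL_qt, datumL_qs, datumL_qu, datumL_ut, datumL_us, datumL_ts, *]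
        · refine ⟨.L0111, ?_⟩
          constructor <;> norm_num [Entry.datum, datumL_qt, datumL_qs, datumL_qu, datumL_ut, datumL_us, datumL_ts, *]
    · by_cases hQS : det₂ X.q X.s = 0
      · by_cases hTS : det₂ X.t X.s = 0
        · refine ⟨.quasi3 1 (Or.inr (Or.inr rfl)), ?_⟩
          constructor <;> norm_num [Entry.datum, datumL_qt, datumL_qs, datumL_qu, datumL_ut, datumL_us, datumL_ts, *]
        · refine ⟨.L0110, ?_⟩
          constructor <;> norm_num [Entry.datum, datumL_qt, datumL_qs, datumL_qu, datumL_ut, datumL_us, datumL_ts, *]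
      · by_cases hκ : det₂ X.q X.s * det₂ X.q X.u = det₂ X.q X.t ^ 2
        · by_cases hTS : det₂ X.t X.s = 0
          · refine ⟨.quasi5 2 4 (Or.inr ⟨rfl, rfl⟩), ?_⟩
            constructor <;> norm_num [Entry.datum, datumL_qt, datumL_qs, datumL_qu, datumL_ut, datumL_us, datumL_ts, *]
            ring
          · refine ⟨.L0124, ?_⟩
            constructor <;> norm_num [Entry.datum, datumL_qt, datumL_qs, datumL_qu, datumL_ut, datumL_us, datumL_ts, *]
            ring
        · have hd : det₂ X.q X.t ^ 2 - det₂ X.q X.s * det₂ X.q X.u ≠ 0 :=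
            sub_ne_zero.2 (Ne.symm hκ)
          -- With `β₃ = 0`, `β₄ = z` the ratio `κ = QS * QU / QT ^ 2` equals `(z - 1) / z`, so `z =
          -- 1 / (1 - κ)`. The value `κ = 1` is never reached; it is supplied by `β₃ = 2`, `β₄ = 4`
          -- in the preceding branch.
          obtain ⟨z, hz⟩ : ∃ z, z = det₂ X.q X.t ^ 2 /
            (det₂ X.q X.t ^ 2 - det₂ X.q X.s * det₂ X.q X.u) := ⟨_, rfl⟩
          have hz0 : z ≠ 0 := by
            rw [hz]
            positivity
          have hz2 : z * (det₂ X.q X.t ^ 2 - det₂ X.q X.s * det₂ X.q X.u) = det₂ X.q X.t ^ 2 := by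
            rw [hz, div_mul_cancel₀ _ hd]
          have hz1 : z ≠ 1 := by
            rintro rfl
            apply mul_ne_zero hQS hQU
            linear_combination -hz2
          have hinv : det₂ X.q X.s * det₂ X.q X.u * z ^ 2 = z * (z - 1) * det₂ X.q X.t ^ 2 := by
            linear_combination -z * hz2
          by_cases hTS : det₂ X.t X.s = 0
          · refine ⟨.quasi4 z hz0, ?_⟩
            constructor <;> simp [Entry.datum, datumL_qt, datumL_qs, datumL_qu, datumL_ut, datumL_us,
              datumL_ts, hQU, hQT, hQS, hTS, hz0, hz1, sub_eq_zero]
            linear_combination hinv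
          · refine ⟨.L100 z hz0, ?_⟩
            constructor <;> simp [Entry.datum, datumL_qt, datumL_qs, datumL_qu, datumL_ut, datumL_us,
              datumL_ts, hQU, hQT, hQS, hTS, hz0, hz1, sub_eq_zero]
            linear_combination hinv

set_option maxHeartbeats 2000000 in
-- Most pairs differ in a vanishing condition. The rest involve a parameter, which the relevant
-- ratio determines: `(z - 1) / z` is injective and never 1.
theorem Entry.eq_of_same {p q : Entry} (h : p.datum.Same q.datum) : p = q := by
  obtain ⟨h1, h2, h3, h4, h5, h6, h7, h8⟩ := h
  rcases p with _ | _ | _ | _ | ⟨β, hβ⟩ | _ | _ | _ | ⟨β, hβ⟩ | _ | _ | _ | _ | _ | _ | _ |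
    ⟨β, rfl | rfl | rfl⟩ | ⟨β, hβ⟩ | ⟨β, _, ⟨rfl, rfl⟩ | ⟨rfl, rfl⟩⟩ | _ <;>
  rcases q with _ | _ | _ | _ | ⟨γ, hγ⟩ | _ | _ | _ | ⟨γ, hγ⟩ | _ | _ | _ | _ | _ | _ | _ |
    ⟨γ, rfl | rfl | rfl⟩ | ⟨γ, hγ⟩ | ⟨γ, _, ⟨rfl, rfl⟩ | ⟨rfl, rfl⟩⟩ | _ <;>
  simp only [Entry.datum, datumL_qt, datumL_qs, datumL_qu, datumL_ut,
      datumL_us, datumL_ts, datumM_qt, datumM_qs, datumM_qu, datumM_ut, datumM_us, datumM_ts,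
      datumLstar_qt, datumLstar_qs, datumLstar_qu, datumLstar_ut, datumLstar_us,
      datumLstar_ts] at h1 h2 h3 h4 h5 h6 h7 h8
  all_goals try rfl
  all_goals try (norm_num at h1; done)
  all_goals try (norm_num at h2; done)
  all_goals try (norm_num at h3; done)
  all_goals try (norm_num at h4; done)
  all_goals try (norm_num at h6; done)
  all_goals try (norm_num at h7; done)
  all_goals try (simp [hβ] at h2; done)
  all_goals try (simp [hγ] at h2; done)
  all_goals try (simp [hβ, sub_eq_zero] at h1; done)
  all_goals try (simp [hγ, sub_eq_zero] at h1; done)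
  all_goals try (simp [hβ] at h4; done)
  all_goals try (simp [hγ] at h4; done)
  all_goals try (simp [hβ, sub_eq_zero] at h6; done)
  all_goals try (simp [hγ, sub_eq_zero] at h6; done)
  case L100.L100 =>
    have : β * γ * (β - γ) = 0 := by linear_combination h5
    obtain rfl : β = γ := by simpa [hβ, hγ, sub_eq_zero] using this
    rfl
  case quasi4.quasi4 =>
    have : β * γ * (β - γ) = 0 := by linear_combination h5
    obtain rfl : β = γ := by simpa [hβ, hγ, sub_eq_zero] using this
    rfl
  case M1.M1 =>
    have : (β - 1) * (γ - 1) * (β - γ) = 0 := by linear_combination h8 trivial trivial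
    obtain rfl : β = γ := by simpa [hβ, hγ, sub_eq_zero] using this
    rfl
  -- Equal ratios would give `(β - 1) / β = 1`; cleared of denominators, this forces `β = 0`.
  case L100.L0124 => exact absurd (by linear_combination -(1 / 4) * h5) hβ
  case L0124.L100 => exact absurd (by linear_combination (1 / 4) * h5) hγ
  case quasi4.quasi5.inr => exact absurd (by linear_combination -(1 / 4) * h5) hβ
  case quasi5.inr.quasi4 => exact absurd (by linear_combination (1 / 4) * h5) hγ
  case M1.M22 => exact absurd (sub_eq_zero.1 ((h7 trivial trivial).2 (sub_self 2))).symm hβ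
  case M22.M1 => exact absurd (sub_eq_zero.1 ((h7 trivial trivial).1 (sub_self 2))).symm hγ

end LeibnizExt

open LeibnizExt

theorem theorem4p4 (n : ℕ) (hn : 4 ≤ n) :
    -- every two-dimensional non-split central extension of `F_n^1` is in the list
    (∀ (E : Type*) [AddCommGroup E] [Module ℂ E] (b : LeibnizExt.Mult E),
      LeibnizExt.IsCentralExtension 2 (LeibnizExt.algF1 n) b → ¬ LeibnizExt.IsSplit b →
        ∃ p : LeibnizExt.Entry, LeibnizExt.Isomorphic b (p.alg n)) ∧
    -- the algebras of the list are pairwise non-isomorphic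
    (∀ p q : LeibnizExt.Entry, LeibnizExt.Isomorphic (p.alg n) (q.alg n) → p = q) ∧
    -- they are all two-dimensional non-split central extensions of `F_n^1`
    (∀ p : LeibnizExt.Entry,
      LeibnizExt.IsCentralExtension 2 (LeibnizExt.algF1 n) (p.alg n) ∧
        ¬ LeibnizExt.IsSplit (p.alg n)) := by
  obtain ⟨k, rfl⟩ := Nat.exists_eq_add_of_le' (show 2 ≤ n by omega)
  have hk : 2 ≤ k := by omega
  have hk' : 1 ≤ k := by omega
  refine ⟨?_, ?_, ?_⟩
  · intro E _ _ b hb hns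
    obtain ⟨X, hX⟩ := hb.exists_model_isomorphic hk'
    have hXs : X.Spans := Datum.spans_of_not_isSplit fun h => hns (h.of_isomorphic hX)
    obtain ⟨p, hp⟩ := Entry.exists_same hXs
    exact ⟨p, hX.symm.trans (((hp.equivalent hk' hXs).isomorphic hk').trans
      (p.model_isomorphic hk))⟩
  · intro p q h
    exact Entry.eq_of_same (Datum.equivalent_of_isomorphic hk q.datum_spans
      ((p.model_isomorphic hk).trans (h.trans (q.model_isomorphic hk).symm))).same
  · intro p
    exact ⟨(model_isCentralExtension hk' _).of_isomorphic (p.model_isomorphic hk),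
      fun h => (p.datum_spans).not_isSplit hk' (h.of_isomorphic (p.model_isomorphic hk).symm)⟩
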